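/- **Setting.** Let $G$ be a finite group of real orthogonal $m\times m$ matrices. A *signed permutation representation* (signed perm-rep) of degree $n$ is a homomorphism $\rho$ from $G$ to the group of $n\times n$ signed permutation matrices; two of them are *equivalent* if they are conjugate by a signed permutation matrix. Write uniquely $\rho(g)=\pi(g)\zeta(g)$ with $\pi(g)$ a permutation matrix and $\zeta(g)$ a diagonal matrix of signs. For subgroups $K\le H\le G$ with $|H:K|\le 2$, let $\rho_{HK}=\mathrm{Ind}_H^G\sigma$, of degree $|G/H|$, where $\sigma:H\to\{\pm1\}$ has kernel $K$: for a transversal $\{g_x\}$ of $G/H$ and $y=gx$, $\rho_{HK}(g)e_x=\sigma(g_y^{-1}g\,g_x)\,e_y$. **Architectures.** A *$G$-DNN architecture* of depth $d\ge1$ is a sequence of signed perm-reps $\rho^{(1)},\dots,\rho^{(d)}$ of degrees $n_2,\dots,n_{d+1}\ge1$, where $n_{d+1}=1$ and $\rho^{(d)}$ is trivial. It is *single-channel* if each $\rho^{(i)}$ is given (up to the order of the coordinates) as a direct sum $\bigoplus_{j=1}^{r^{(i)}}\rho_{H^{(i)}_jK^{(i)}_j}$ of pairwise inequivalent summands. Put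 $n_1=m$, $N_i=n_1+\dots+n_i$. For weights $W^{(i)}\in\mathbb R^{n_{i+1}\times N_i}$ and biases $b^{(i)}\in\mathbb R^{n_{i+1}}$ ($1\le i\le d$), let $f^{(1)}(x)=x$, $$f^{(i+1)}(x)=\begin{pmatrix}\mathrm{ReLU}(W^{(i)}f^{(i)}(x)+b^{(i)})\\ f^{(i)}(x)\end{pmatrix}\ (1\le i<d),\qquad f(x)=W^{(d)}f^{(d)}(x)+b^{(d)},$$ and let $\psi^{(1)}(g)=g$, $$\psi^{(i+1)}(g)=\begin{pmatrix}\pi^{(i)}(g)&\tfrac12\big(W^{(i)}\psi^{(i)}(g)-\pi^{(i)}(g)W^{(i)}\big)\\0&\psi^{(i)}(g)\end{pmatrix}\ (1\le i<d).$$ These parameters define a *$G$-DNN* with the given architecture if $\rho^{(i)}(g)W^{(i)}=W^{(i)}\psi^{(i)}(g)$ and $\rho^{(i)}(g)b^{(i)}=b^{(i)}$ for all $g\in G$ and $1\le i\le d$, and $f$ is $G$-invariant. The architecture is *admissible* if it admits a $G$-DNN such that, for every $1\le i\le d$, every row of $W^{(i)}$ is nonzero and no two rows of $[W^{(i)}\mid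 b^{(i)}]$ are parallel (that is, linearly dependent). **The functions $\phi^{(i)}$.** For a finite group $\Gamma$ of orthogonal matrices let $P_\Gamma=\frac1{|\Gamma|}\sum_{\gamma\in\Gamma}\gamma$. For a subgroup $J\le G$ let $\pi_J$ be the permutation representation of $G$ on $G/J$. For $K\le H\le G$ with $|H:K|\le2$ define $$\theta(H,K,J)=\{g\in G:\pi_J(g)M_J=M_J\},\qquad M_J=P_{\pi_J(K)}-(|H:K|-1)P_{\pi_J(H)},$$ $$\phi^{(1)}(H,K)=\{g\in G: gM=M\},\qquad M=P_K-(|H:K|-1)P_H,$$ $$\phi^{(i+1)}(H,K)=\phi^{(i)}(H,K)\cap\bigcap_{j=1}^{r^{(i)}}\theta(H,K,H^{(i)}_j)\qquad(1\le i<d).$$ **Theorem.** A single-channel $G$-DNN architecture $\rho^{(1)},\dots,\rho^{(d)}$ is admissible if and only if both of the following hold: 1. $\phi^{(i)}(H^{(i)}_j,K^{(i)}_j)=K^{(i)}_j$ for all $1\le i\le d$ and $1\le j\le r^{(i)}$; 2. if $H^{(1)}_j=K^{(1)}_j=G$ for some $j$ (that is, if the trivial representation occurs in $\rho^{(1)}$),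 then $P_G\ne0$. -/

import Mathlib

open scoped Classical

noncomputable section

namespace GDNN

/-! ### Signed permutation representations -/

/-- A signed permutation matrix: column `b` has the single nonzero entry `ε b = ±1`, in row `e b`.
(Rows and columns may be labelled by different sets of the same size.) -/
def IsSignedPermMatrix {ι κ : Type*} (A : Matrix κ ι ℝ) : Prop :=
  ∃ (e : ι ≃ κ) (ε : ι → ℝ), (∀ b, ε b = 1 ∨ ε b = -1) ∧
    ∀ a b, A a b = if a = e b then ε b else 0

/-- A signed permutation representation of `Γ`, on coordinates labelled by `ι`. -/
structure SignedPermRep (Γ : Type*) [Group Γ] (ι : Type*) [Fintype ι] [DecidableEq ι] where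
  toHom : Γ →* Matrix ι ι ℝ
  signed : ∀ g, IsSignedPermMatrix (toHom g)

/-- Two signed permutation representations are equivalent if a signed permutation matrix
conjugates one into the other. -/
def SignedPermRep.Equivalent {Γ : Type*} [Group Γ] {ι κ : Type*} [Fintype ι] [DecidableEq ι]
    [Fintype κ] [DecidableEq κ] (ρ : SignedPermRep Γ ι) (ρ' : SignedPermRep Γ κ) : Prop :=
  ∃ A : Matrix κ ι ℝ, IsSignedPermMatrix A ∧ ∀ g, ρ'.toHom g * A = A * ρ.toHom g

/-- The permutation part `π(g)` in the unique factorization `ρ(g) = π(g) ζ(g)` into a permutation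
matrix and a diagonal matrix of signs: the signs are removed from the entries. -/
def SignedPermRep.permPart {Γ : Type*} [Group Γ] {ι : Type*} [Fintype ι] [DecidableEq ι]
    (ρ : SignedPermRep Γ ι) (g : Γ) : Matrix ι ι ℝ :=
  (ρ.toHom g).map fun x => |x|

/-- Sanity check: `permPart` is indeed the permutation matrix in the factorization. -/
theorem SignedPermRep.permPart_spec {Γ : Type*} [Group Γ] {ι : Type*} [Fintype ι] [DecidableEq ι]
    (ρ : SignedPermRep Γ ι) (g : Γ) (σ : Equiv.Perm ι) (ε : ι → ℝ)
    (hε : ∀ b, ε b = 1 ∨ ε b = -1)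
    (h : ρ.toHom g = σ.permMatrix ℝ * Matrix.diagonal ε) : ρ.permPart g = σ.permMatrix ℝ := by
  ext a b
  have hb : |ε b| = 1 := by rcases hε b with h | h <;> simp [h]
  simp only [SignedPermRep.permPart, h, Matrix.map_apply, Matrix.mul_diagonal, abs_mul, hb, mul_one]
  simp only [Equiv.Perm.permMatrix, PEquiv.toMatrix_apply]
  split_ifs <;> simp

/-- Data for the irreducible signed permutation representation `ρ_{HK}`: subgroups `K ≤ H` with
`|H : K| ≤ 2` and a transversal of `Γ ⧸ H`. -/
structure IrrepData (Γ : Type*) [Group Γ] where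
  H : Subgroup Γ
  K : Subgroup Γ
  le : K ≤ H
  relIndex_le : K.relIndex H ≤ 2
  transversal : Γ ⧸ H → Γ
  transversal_spec : ∀ x : Γ ⧸ H, (transversal x : Γ ⧸ H) = x

/-- On `H`, this is the homomorphism to `{1, -1}` with kernel `K` (where `|H : K| ≤ 2`). -/
def sgn {Γ : Type*} [Group Γ] (K : Subgroup Γ) (h : Γ) : ℝ := if h ∈ K then 1 else -1

theorem sgn_mul {Γ : Type*} [Group Γ] [Finite Γ] {H K : Subgroup Γ}
    (hi : K.relIndex H ≤ 2) {a b : Γ} (ha : a ∈ H) (hb : b ∈ H) :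
    sgn K (a * b) = sgn K a * sgn K b := by
  have h0 : K.relIndex H ≠ 0 := Subgroup.index_ne_zero_of_finite
  have hcases : K.relIndex H = 1 ∨ K.relIndex H = 2 := by omega
  rcases hcases with h1 | h2
  · have hHK : H ≤ K := Subgroup.relIndex_eq_one.mp h1
    simp [sgn, hHK ha, hHK hb, mul_mem (hHK ha) (hHK hb)]
  · have key := Subgroup.mul_mem_iff_of_index_two (H := K.subgroupOf H) h2
      (a := ⟨a, ha⟩) (b := ⟨b, hb⟩)
    simp only [Subgroup.mem_subgroupOf, Subgroup.coe_mul] at key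
    by_cases h3 : a ∈ K <;> by_cases h4 : b ∈ K <;> simp [sgn, key, h3, h4]

/-- The matrix of `ρ_{HK}(g)`: with `t` the transversal, the basis vector of the coset `y` goes to
plus or minus the basis vector of the coset `x = g y`; the sign is plus iff `g t(y) K = t(x) K`. -/
def IrrepData.mat {Γ : Type*} [Group Γ] (p : IrrepData Γ) (g : Γ) :
    Matrix (Γ ⧸ p.H) (Γ ⧸ p.H) ℝ :=
  Matrix.of fun x y =>
    if x = g • y then sgn p.K ((p.transversal x)⁻¹ * (g * p.transversal y)) else 0

theorem IrrepData.mem_H {Γ : Type*} [Group Γ] (p : IrrepData Γ) (g : Γ) (y : Γ ⧸ p.H) :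
    (p.transversal (g • y))⁻¹ * (g * p.transversal y) ∈ p.H := by
  rw [← QuotientGroup.eq, p.transversal_spec]
  conv_lhs => rw [← p.transversal_spec y]
  rfl

/-- The signed permutation representation `ρ_{HK}`. -/
def IrrepData.rep {Γ : Type*} [Group Γ] [Fintype Γ] (p : IrrepData Γ) :
    SignedPermRep Γ (Γ ⧸ p.H) where
  toHom :=
    { toFun := p.mat
      map_one' := by
        ext x y
        by_cases h : x = y
        · subst h; simp [IrrepData.mat, sgn, one_mem]
        · simp [IrrepData.mat, h]
      map_mul' := by
        intro g g'
        ext x y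
        rw [Matrix.mul_apply, Finset.sum_eq_single (g' • y)]
        · by_cases h : x = g • g' • y
          · subst h
            simp only [IrrepData.mat, Matrix.of_apply, mul_smul, if_true]
            rw [← sgn_mul p.relIndex_le (p.mem_H g (g' • y)) (p.mem_H g' y)]
            congr 1
            group
          · simp [IrrepData.mat, mul_smul, h]
        · intro z _ hz
          simp [IrrepData.mat, hz]
        · simp }
  signed := fun g => by
    refine ⟨MulAction.toPerm g, fun y => sgn p.K ((p.transversal (g • y))⁻¹ *
      (g * p.transversal y)), fun b => ?_, fun a b => ?_⟩
    · simp only [sgn]; split_ifs <;> simp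
    · by_cases h : a = g • b
      · subst h; simp [IrrepData.mat]
      · simp [IrrepData.mat, h]

/-- A single-channel decomposition of a signed permutation representation: a direct sum of pairwise
inequivalent `ρ_{H_j K_j}`, where the coordinates of the direct sum may be listed in any order. -/
structure Decomposition {Γ : Type*} [Group Γ] [Fintype Γ] {n : ℕ}
    (ρ : SignedPermRep Γ (Fin n)) where
  r : ℕ
  irr : Fin r → IrrepData Γ
  inequivalent : ∀ j k, j ≠ k → ¬ (irr j).rep.Equivalent (irr k).rep
  labels : (Σ j, Γ ⧸ (irr j).H) ≃ Fin n
  eq_directSum : ∀ g, ρ.toHom g =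
    Matrix.reindex labels labels (Matrix.blockDiagonal' fun j => (irr j).rep.toHom g)

/-! ### The functions `θ` and `φ` -/

/-- `P_S = |S|⁻¹ ∑_{A ∈ S} A`, for a finite group `S` of matrices. -/
def invProj {ι : Type*} (S : Set (Matrix ι ι ℝ)) : Matrix ι ι ℝ :=
  (S.ncard : ℝ)⁻¹ • ∑ᶠ A ∈ S, A

/-- `{g ∈ Γ : τ(g) M = M}`. -/
def stab {Γ : Type*} [Group Γ] {ι : Type*} [Fintype ι] [DecidableEq ι]
    (τ : Γ →* Matrix ι ι ℝ) (M : Matrix ι ι ℝ) : Subgroup Γ where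
  carrier := {g | τ g * M = M}
  one_mem' := by simp
  mul_mem' := by
    intro a b ha hb
    simp only [Set.mem_ofPred_eq] at ha hb ⊢
    rw [map_mul, Matrix.mul_assoc, hb, ha]
  inv_mem' := by
    intro a ha
    simp only [Set.mem_ofPred_eq] at ha ⊢
    conv_lhs => rw [← ha, ← Matrix.mul_assoc, ← map_mul]
    simp

/-- The stabilizer of `P_{τ(K)} - (|H : K| - 1) P_{τ(H)}` under `τ`. -/
def stabProj {Γ : Type*} [Group Γ] {ι : Type*} [Fintype ι] [DecidableEq ι]
    (τ : Γ →* Matrix ι ι ℝ) (H K : Subgroup Γ) : Subgroup Γ :=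
  stab τ (invProj (τ '' K) - ((K.relIndex H : ℝ) - 1) • invProj (τ '' H))

/-- The ordinary permutation representation `π_J` on the cosets `Γ ⧸ J`. -/
def cosetRep {Γ : Type*} [Group Γ] [Fintype Γ] (J : Subgroup Γ) :
    Γ →* Matrix (Γ ⧸ J) (Γ ⧸ J) ℝ where
  toFun g := Matrix.of fun x y => if x = g • y then 1 else 0
  map_one' := by
    ext x y
    simp [Matrix.one_apply]
  map_mul' g g' := by
    ext x y
    rw [Matrix.mul_apply, Finset.sum_eq_single (g' • y)]
    · simp [mul_smul]
    · intro z _ hz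
      simp [hz]
    · simp

def theta {Γ : Type*} [Group Γ] [Fintype Γ] (H K J : Subgroup Γ) : Subgroup Γ :=
  stabProj (cosetRep J) H K

/-- The defining representation of a group of orthogonal matrices. -/
def defRep {m : ℕ} (G : Subgroup (Matrix.orthogonalGroup (Fin m) ℝ)) :
    G →* Matrix (Fin m) (Fin m) ℝ :=
  (Submonoid.subtype (Matrix.orthogonalGroup (Fin m) ℝ)).comp G.subtype

/-! ### Architectures, networks, admissibility -/

/-- A `G`-DNN architecture of depth `d = L + 1`. The layers are numbered `0, …, L` (layers `i < L`
are hidden, layer `L` is the output layer); layer `i` has `width i` neurons and transforms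
by `rep i`. The values of `width` and `rep` beyond `L` are irrelevant. -/
structure Architecture (Γ : Type*) [Group Γ] (L : ℕ) where
  width : ℕ → ℕ
  rep : ∀ i, SignedPermRep Γ (Fin (width i))
  width_pos : ∀ i ≤ L, 0 < width i
  width_last : width L = 1
  rep_last : ∀ g, (rep L).toHom g = 1

/-- Labels of the inputs of layer `i`: the neurons of the layers `i - 1, …, 0` and the `m` network
inputs (all skip connections are present). -/
def Inputs (m : ℕ) (n : ℕ → ℕ) : ℕ → Type
  | 0 => Fin m
  | i + 1 => Fin (n i) ⊕ Inputs m n i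

instance Inputs.fintype (m : ℕ) (n : ℕ → ℕ) : ∀ i, Fintype (Inputs m n i)
  | 0 => inferInstanceAs (Fintype (Fin m))
  | i + 1 => @instFintypeSum _ _ (inferInstanceAs (Fintype (Fin (n i)))) (Inputs.fintype m n i)

/-- The parameters of a network with layer widths `n`. -/
structure Params (m : ℕ) (n : ℕ → ℕ) where
  W : ∀ i, Matrix (Fin (n i)) (Inputs m n i) ℝ
  b : ∀ i, Fin (n i) → ℝ

/-- The input of layer `i`, as a function of the network input. -/
def Params.features {m : ℕ} {n : ℕ → ℕ} (P : Params m n) (x : Fin m → ℝ) :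
    ∀ i, Inputs m n i → ℝ
  | 0 => x
  | i + 1 => Sum.elim
      (fun a => max 0 ((P.W i).mulVec (P.features x i) a + P.b i a)) (P.features x i)

/-- The value of layer `i` before any activation. -/
def Params.preactivation {m : ℕ} {n : ℕ → ℕ} (P : Params m n) (x : Fin m → ℝ) (i : ℕ) :
    Fin (n i) → ℝ :=
  (P.W i).mulVec (P.features x i) + P.b i

/-- The representation `ψ` acting on the inputs of layer `i`. -/
def psi {m : ℕ} {G : Subgroup (Matrix.orthogonalGroup (Fin m) ℝ)} {L : ℕ}
    (A : Architecture G L) (P : Params m A.width) (g : G) :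
    ∀ i, Matrix (Inputs m A.width i) (Inputs m A.width i) ℝ
  | 0 => defRep G g
  | i + 1 => Matrix.fromBlocks
      ((A.rep i).permPart g)
      ((1 / 2 : ℝ) • (P.W i * psi A P g i - (A.rep i).permPart g * P.W i))
      0
      (psi A P g i)

/-- The real-valued function of depth `L + 1` computed by the network. -/
def Architecture.network {m : ℕ} {G : Subgroup (Matrix.orthogonalGroup (Fin m) ℝ)} {L : ℕ}
    (A : Architecture G L) (P : Params m A.width) (x : Fin m → ℝ) : ℝ :=
  P.preactivation x L ⟨0, A.width_pos L le_rfl⟩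

/-- The parameters `P` define a `G`-DNN with architecture `A`: they satisfy the equivariance
constraints of `A` in every layer, and the network is `G`-invariant. -/
structure IsGDNN {m : ℕ} {G : Subgroup (Matrix.orthogonalGroup (Fin m) ℝ)} {L : ℕ}
    (A : Architecture G L) (P : Params m A.width) : Prop where
  weight : ∀ i ≤ L, ∀ g, (A.rep i).toHom g * P.W i = P.W i * psi A P g i
  bias : ∀ i ≤ L, ∀ g, ((A.rep i).toHom g).mulVec (P.b i) = P.b i
  invariant : ∀ (g : G) (x : Fin m → ℝ), A.network P ((defRep G g).mulVec x) = A.network P x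

/-- Two vectors are parallel if they are linearly dependent (so antiparallel ones are parallel). -/
def Parallel {κ : Type*} (u v : κ → ℝ) : Prop := ¬ LinearIndependent ℝ ![u, v]

/-- The augmented weight matrix `[W | b]`. -/
def augmented {ι κ : Type*} (W : Matrix ι κ ℝ) (b : ι → ℝ) : Matrix ι (κ ⊕ Unit) ℝ :=
  Matrix.fromCols W (Matrix.replicateCol Unit b)

/-- `A` admits a `G`-DNN in which no row of a weight matrix is zero and no two rows of
an augmented weight matrix are parallel. -/
def Architecture.Admissible {m : ℕ} {G : Subgroup (Matrix.orthogonalGroup (Fin m) ℝ)} {L : ℕ}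
    (A : Architecture G L) : Prop :=
  ∃ P : Params m A.width, IsGDNN A P ∧ ∀ i ≤ L,
    (∀ a, P.W i a ≠ 0) ∧
    ∀ a a', a ≠ a' → ¬ Parallel (augmented (P.W i) (P.b i) a) (augmented (P.W i) (P.b i) a')

/-- The function `φ` of layer `i` (layers numbered from `0`). -/
def phi {m : ℕ} {G : Subgroup (Matrix.orthogonalGroup (Fin m) ℝ)} [Fintype G] {L : ℕ}
    {A : Architecture G L} (D : ∀ i, Decomposition (A.rep i)) :
    ℕ → Subgroup G → Subgroup G → Subgroup G
  | 0, H, K => stabProj (defRep G) H K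
  | i + 1, H, K => phi D i H K ⊓ ⨅ j : Fin (D i).r, theta H K ((D i).irr j).H

end GDNN

end

noncomputable section

namespace GDNN

open Matrix

/-! ### Isotypic vectors -/

section Isotypic

variable {Γ : Type*} [Group Γ] {ι : Type*} [Fintype ι] [DecidableEq ι]

/-! The matrix `psi` is block triangular. Conjugating it by the unipotent matrix `ofDiag` turns it
into `inputRep`, the orthogonal direct sum of the permutation parts of the earlier layers and the
defining representation (`psi_mul_ofDiag`). With V = W * `ofDiag`, equivariance of a layer says that
V intertwines `inputRep` with ρ. Every family of such V arises from weights (`exists_weights`), and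
nonzero or parallel rows are unaffected by the invertible change of basis.

By Frobenius reciprocity (`Decomposition.intertwines_iff`), V amounts to one vector v_j per summand
on which H_j acts through the sign with kernel K_j; the rows of V are translates of v_j. The matrix
defining θ and φ projects onto such vectors, so φ(H, K) is their pointwise stabilizer
(`mem_phi_iff`).

If φ(H_j, K_j) exceeds K_j, then either v_j = 0 or two rows of a summand agree up to sign, their
biases included (`Decomposition.mem_of_fixes_isotypic`). Conversely, if φ(H_j, K_j) = K_j, a generic
v_j has stabilizer K_j, provided a nonzero one exists. That can fail only for the trivial summand of
the first layer, which is where condition 2 enters. With bias 1 on unsigned and 0 on signed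
summands, parallel rows would make two cosets equal or two summands equivalent
(`Decomposition.exists_intertwiner`). Invariance of the network then follows from ReLU(t) = (t +
|t|)/2. -/

/-- The vectors on which `H` acts through the sign character with kernel `K`. -/
def isotypic (τ : Γ →* Matrix ι ι ℝ) (H K : Subgroup Γ) : Submodule ℝ (ι → ℝ) where
  carrier := {v | ∀ h ∈ H, τ h *ᵥ v = sgn K h • v}
  zero_mem' := by intro h _; simp
  add_mem' := by
    intro a b ha hb h hh
    rw [mulVec_add, ha h hh, hb h hh, smul_add]
  smul_mem' := by
    intro c a ha h hh
    rw [mulVec_smul, ha h hh, smul_comm]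

theorem mem_isotypic {τ : Γ →* Matrix ι ι ℝ} {H K : Subgroup Γ} {v : ι → ℝ} :
    v ∈ isotypic τ H K ↔ ∀ h ∈ H, τ h *ᵥ v = sgn K h • v := Iff.rfl

theorem sgn_of_mem {K : Subgroup Γ} {h : Γ} (hh : h ∈ K) : sgn K h = 1 := by simp [sgn, hh]

theorem sgn_of_notMem {K : Subgroup Γ} {h : Γ} (hh : h ∉ K) : sgn K h = -1 := by simp [sgn, hh]

theorem sgn_one {K : Subgroup Γ} : sgn K (1 : Γ) = 1 := sgn_of_mem K.one_mem

theorem sgn_mul_self (K : Subgroup Γ) (h : Γ) : sgn K h * sgn K h = 1 := by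
  simp only [sgn]; split_ifs <;> simp

theorem hom_mulVec_mul (τ : Γ →* Matrix ι ι ℝ) (a b : Γ) (v : ι → ℝ) :
    τ (a * b) *ᵥ v = τ a *ᵥ (τ b *ᵥ v) := by
  rw [map_mul, mulVec_mulVec]

theorem hom_one_mulVec (τ : Γ →* Matrix ι ι ℝ) (v : ι → ℝ) : τ 1 *ᵥ v = v := by
  rw [map_one, one_mulVec]

theorem hom_inv_mulVec_eq_iff (τ : Γ →* Matrix ι ι ℝ) (a : Γ) (v w : ι → ℝ) :
    τ a⁻¹ *ᵥ v = w ↔ v = τ a *ᵥ w := by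
  constructor
  · rintro rfl
    rw [← hom_mulVec_mul, mul_inv_cancel, hom_one_mulVec]
  · rintro rfl
    rw [← hom_mulVec_mul, inv_mul_cancel, hom_one_mulVec]

theorem vecMul_eq_inv_mulVec {τ : Γ →* Matrix ι ι ℝ} (hτ : ∀ g, (τ g)ᵀ = τ g⁻¹) (g : Γ)
    (v : ι → ℝ) : v ᵥ* τ g = τ g⁻¹ *ᵥ v := by
  rw [← hτ, mulVec_transpose]

/-- An isotypic vector with stabilizer `K` is negated only by elements of `H`, if `K ≠ H`. -/
theorem mem_of_mulVec_eq_neg {τ : Γ →* Matrix ι ι ℝ} {H K : Subgroup Γ} (hle : K ≤ H)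
    (hne : K ≠ H) {v : ι → ℝ} (hv : v ∈ isotypic τ H K) (hstab : ∀ g, τ g *ᵥ v = v → g ∈ K)
    {g : Γ} (hg : τ g *ᵥ v = -v) : g ∈ H := by
  obtain ⟨h, hh, hk⟩ := SetLike.exists_of_lt (lt_of_le_of_ne hle hne)
  -- An element h of H outside K also negates v, so g * h fixes v.
  have := hstab (g * h) (by
    rw [hom_mulVec_mul, hv h hh, sgn_of_notMem hk, neg_one_smul, mulVec_neg, hg, neg_neg])
  exact (H.mul_mem_cancel_right hh).mp (hle this)

theorem dotProduct_mulVec_mulVec {τ : Γ →* Matrix ι ι ℝ} (hτ : ∀ g, (τ g)ᵀ = τ g⁻¹) (g : Γ)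
    (v : ι → ℝ) : (τ g *ᵥ v) ⬝ᵥ (τ g *ᵥ v) = v ⬝ᵥ v := by
  rw [dotProduct_mulVec, vecMul_eq_inv_mulVec hτ, ← hom_mulVec_mul, inv_mul_cancel,
    hom_one_mulVec]

/-- The average of a representation over a subgroup. -/
def average [Fintype Γ] (τ : Γ →* Matrix ι ι ℝ) (K : Subgroup Γ) : Matrix ι ι ℝ :=
  (Fintype.card K : ℝ)⁻¹ • ∑ k : K, τ k

theorem hom_mul_average [Fintype Γ] (τ : Γ →* Matrix ι ι ℝ) (K : Subgroup Γ) {k : Γ}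
    (hk : k ∈ K) : τ k * average τ K = average τ K := by
  rw [average, Matrix.mul_smul, Finset.mul_sum]
  congr 1
  refine Fintype.sum_equiv (Equiv.mulLeft ⟨k, hk⟩) _ _ fun x => ?_
  simp

theorem average_mul_hom [Fintype Γ] (τ : Γ →* Matrix ι ι ℝ) (K : Subgroup Γ) {k : Γ}
    (hk : k ∈ K) : average τ K * τ k = average τ K := by
  rw [average, Matrix.smul_mul, Finset.sum_mul]
  congr 1
  refine Fintype.sum_equiv (Equiv.mulRight ⟨k, hk⟩) _ _ fun x => ?_
  simp

theorem average_mulVec_of_fixed [Fintype Γ] (τ : Γ →* Matrix ι ι ℝ) (K : Subgroup Γ) {v : ι → ℝ}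
    (hv : ∀ k ∈ K, τ k *ᵥ v = v) : average τ K *ᵥ v = v := by
  rw [average, smul_mulVec, sum_mulVec, Finset.sum_congr rfl fun (k : K) _ => hv k k.2]
  have : (Fintype.card K : ℝ) ≠ 0 := by exact_mod_cast Fintype.card_ne_zero
  rw [Finset.sum_const, Finset.card_univ, ← Nat.cast_smul_eq_nsmul ℝ, inv_smul_smul₀ this]

/-- Averaging over the image of a subgroup is averaging over the subgroup. -/
theorem invProj_image [Fintype Γ] (τ : Γ →* Matrix ι ι ℝ) (K : Subgroup Γ) :
    invProj (τ '' K) = average τ K := by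
  have hfin : (τ '' (K : Set Γ)).Finite := Set.toFinite _
  have hsum : ∑ᶠ A ∈ τ '' (K : Set Γ), A = ∑ A ∈ hfin.toFinset, A :=
    finsum_mem_eq_finite_toFinset_sum _ hfin
  have hcard : ((τ '' (K : Set Γ)).ncard : ℝ) = (hfin.toFinset.card : ℝ) := by
    rw [Set.ncard_eq_toFinset_card _ hfin]
  have hne : (hfin.toFinset.card : ℝ) ≠ 0 := by
    have : (1 : Matrix ι ι ℝ) ∈ hfin.toFinset := by
      simpa using ⟨1, K.one_mem, map_one τ⟩
    exact_mod_cast Finset.card_ne_zero_of_mem this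
  -- The product of the two averages equals each factor, so fibres of τ need not be counted.
  have hleft : invProj (τ '' K) * average τ K = average τ K := by
    rw [invProj, hsum, hcard, Matrix.smul_mul, Finset.sum_mul,
      Finset.sum_congr rfl (g := fun _ => average τ K)]
    · rw [Finset.sum_const, ← Nat.cast_smul_eq_nsmul ℝ, inv_smul_smul₀ hne]
    · intro A hA
      obtain ⟨k, hk, rfl⟩ : ∃ k ∈ K, τ k = A := by simpa using hA
      exact hom_mul_average τ K hk
  have hinv : ∀ k : K, invProj (τ '' K) * τ k = invProj (τ '' K) := by
    intro k
    rw [invProj, hsum, Matrix.smul_mul, Finset.sum_mul]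
    congr 1
    have hcancel : ∀ A : Matrix ι ι ℝ, A * τ k * τ (k : Γ)⁻¹ = A := fun A => by
      rw [Matrix.mul_assoc, ← map_mul, mul_inv_cancel, map_one, Matrix.mul_one]
    have hcancel' : ∀ A : Matrix ι ι ℝ, A * τ (k : Γ)⁻¹ * τ k = A := fun A => by
      rw [Matrix.mul_assoc, ← map_mul, inv_mul_cancel, map_one, Matrix.mul_one]
    refine Finset.sum_bij' (fun A _ => A * τ k) (fun A _ => A * τ (k : Γ)⁻¹) ?_ ?_
      (fun A _ => hcancel A) (fun A _ => hcancel' A) (fun _ _ => rfl)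
    · intro A hA
      obtain ⟨l, hl, rfl⟩ : ∃ l ∈ K, τ l = A := by simpa using hA
      simpa using ⟨l * k, K.mul_mem hl k.2, map_mul τ _ _⟩
    · intro A hA
      obtain ⟨l, hl, rfl⟩ : ∃ l ∈ K, τ l = A := by simpa using hA
      simpa using ⟨l * (k : Γ)⁻¹, K.mul_mem hl (K.inv_mem k.2), map_mul τ _ _⟩
  have hne' : (Fintype.card K : ℝ) ≠ 0 := by exact_mod_cast Fintype.card_ne_zero
  rw [← hleft, average, Matrix.mul_smul, Finset.mul_sum, Finset.sum_congr rfl fun k _ => hinv k,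
    Finset.sum_const, Finset.card_univ, ← Nat.cast_smul_eq_nsmul ℝ, inv_smul_smul₀ hne']

theorem relIndex_eq_one_or_two [Fintype Γ] {H K : Subgroup Γ} (hi : K.relIndex H ≤ 2) :
    K.relIndex H = 1 ∨ K.relIndex H = 2 := by
  have h0 : K.relIndex H ≠ 0 := Subgroup.index_ne_zero_of_finite
  omega

/-- For index two, an element of `H \ K` interchanges the two halves of the average over `H`. -/
theorem hom_mul_average_add [Fintype Γ] (τ : Γ →* Matrix ι ι ℝ) {H K : Subgroup Γ} (hle : K ≤ H)
    (hi : K.relIndex H = 2) {h : Γ} (hh : h ∈ H) (hk : h ∉ K) :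
    τ h * average τ K + average τ K = (2 : ℝ) • average τ H := by
  have hcard : (Fintype.card H : ℝ) = 2 * Fintype.card K := by
    have := (K.subgroupOf H).card_mul_index
    rw [show (K.subgroupOf H).index = 2 from hi,
      Nat.card_congr (Subgroup.subgroupOfEquivOfLe hle).toEquiv, Nat.card_eq_fintype_card,
      Nat.card_eq_fintype_card] at this
    rw [← this]
    push_cast
    ring
  -- H is the disjoint union of hK and K.
  have hsum : ∑ a : H, τ a = τ h * (∑ k : K, τ k) + ∑ k : K, τ k := by
    have key : ∀ J : Subgroup Γ, ∑ a : J, τ a = ∑ a with a ∈ J, τ a := fun J =>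
      (Finset.sum_subtype _ (by simp) τ).symm
    rw [key H, key K, ← Finset.sum_filter_not_add_sum_filter _ (fun a => a ∈ K), Finset.filter_filter,
      Finset.filter_filter, Finset.mul_sum]
    congr 1
    · symm
      refine Finset.sum_bij' (fun a _ => h * a) (fun a _ => h⁻¹ * a) ?_ ?_ (by simp) (by simp)
        (by simp)
      · intro a ha
        simp only [Finset.mem_filter, Finset.mem_univ, true_and] at ha ⊢
        exact ⟨H.mul_mem hh (hle ha), fun h1 => hk ((K.mul_mem_cancel_right ha).mp h1)⟩
      · intro a ha
        simp only [Finset.mem_filter, Finset.mem_univ, true_and] at ha ⊢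
        by_contra hcon
        have := sgn_mul hi.le (H.inv_mem hh) ha.1
        rw [sgn_of_notMem hcon, sgn_of_notMem (mt K.inv_mem_iff.mp hk), sgn_of_notMem ha.2] at this
        norm_num at this
    · refine Finset.sum_congr (Finset.filter_congr fun a _ => ?_) fun _ _ => rfl
      exact ⟨fun h => h.2, fun h => ⟨hle h, h⟩⟩
  have hne' : (Fintype.card K : ℝ) ≠ 0 := by exact_mod_cast Fintype.card_ne_zero
  rw [average, average, hsum, hcard, smul_smul, Matrix.mul_smul, ← smul_add]
  congr 1
  field_simp

/-- The elements fixing `P_{τ(K)} - (|H : K| - 1) P_{τ(H)}` are those fixing every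
isotypic vector. -/
theorem mem_stabProj_iff [Fintype Γ] (τ : Γ →* Matrix ι ι ℝ) {H K : Subgroup Γ} (hle : K ≤ H)
    (hi : K.relIndex H ≤ 2) (g : Γ) :
    g ∈ stabProj τ H K ↔ ∀ v ∈ isotypic τ H K, τ g *ᵥ v = v := by
  set M := average τ K - ((K.relIndex H : ℝ) - 1) • average τ H with hM
  have hmem : g ∈ stabProj τ H K ↔ τ g * M = M := by
    rw [stabProj, invProj_image, invProj_image]; rfl
  have hfix : ∀ v ∈ isotypic τ H K, ∀ k ∈ K, τ k *ᵥ v = v := fun v hv k hk => by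
    rw [hv k (hle hk), sgn_of_mem hk, one_smul]
  -- `hrange` and `hid` say that M projects onto the isotypic space. M is P_K for index one and P_K
  -- - P_H for index two.
  have hrange : ∀ u, M *ᵥ u ∈ isotypic τ H K := by
    intro u h hh
    rw [mulVec_mulVec, ← smul_mulVec]
    congr 1
    rcases relIndex_eq_one_or_two hi with h1 | h2
    · have hHK : K = H := le_antisymm hle (Subgroup.relIndex_eq_one.mp h1)
      subst hHK
      rw [sgn_of_mem hh, one_smul, hM, h1]
      simp [hom_mul_average τ K hh]
    · rw [hM, h2, Matrix.mul_sub, Matrix.mul_smul, hom_mul_average τ H hh]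
      by_cases hk : h ∈ K
      · rw [sgn_of_mem hk, one_smul, hom_mul_average τ K hk]
      · rw [sgn_of_notMem hk, eq_sub_of_add_eq (hom_mul_average_add τ hle h2 hh hk)]
        push_cast
        module
  have hid : ∀ v ∈ isotypic τ H K, M *ᵥ v = v := by
    intro v hv
    rw [hM, sub_mulVec, smul_mulVec, average_mulVec_of_fixed τ K (hfix v hv)]
    rcases relIndex_eq_one_or_two hi with h1 | h2
    · simp [h1]
    · have : average τ H *ᵥ v = 0 := by
        obtain ⟨h, hh, hk⟩ : ∃ h ∈ H, h ∉ K := by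
          by_contra! hcon
          have := Subgroup.relIndex_eq_one.mpr hcon
          omega
        -- P_H absorbs τ h, while h negates v.
        have h1 : average τ H *ᵥ v = -(average τ H *ᵥ v) := by
          conv_lhs => rw [← average_mul_hom τ H hh, ← mulVec_mulVec, hv h hh, sgn_of_notMem hk,
            neg_one_smul, mulVec_neg]
        exact self_eq_neg.mp h1
      simp [this]
  rw [hmem]
  constructor
  · intro h v hv
    conv_lhs => rw [← hid v hv, mulVec_mulVec, h, hid v hv]
  · intro h
    refine Matrix.ext_of_mulVec_single fun i => ?_
    rw [← mulVec_mulVec]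
    exact h _ (hrange _)

/-- P_G projects onto the invariant vectors, which are the isotypic vectors for H = K = G. -/
theorem invProj_range_ne_zero_iff [Fintype Γ] (τ : Γ →* Matrix ι ι ℝ) :
    invProj (Set.range τ) ≠ 0 ↔ ∃ v ∈ isotypic τ ⊤ ⊤, v ≠ 0 := by
  have : Set.range τ = τ '' ((⊤ : Subgroup Γ) : Set Γ) := by simp
  rw [this, invProj_image]
  constructor
  · intro h
    by_contra! hv
    refine h (Matrix.ext_of_mulVec_single fun i => ?_)
    rw [zero_mulVec]
    refine hv _ fun g hg => ?_
    rw [mulVec_mulVec, hom_mul_average τ ⊤ hg, sgn_of_mem hg, one_smul]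
  · rintro ⟨v, hv, hne⟩ h
    apply hne
    rw [← average_mulVec_of_fixed τ ⊤ fun k hk => (hv k hk).trans
      (by rw [sgn_of_mem hk, one_smul]), h, zero_mulVec]

/-- If the pointwise stabilizer of the isotypic vectors is `K`, then a generic isotypic
vector has stabilizer `K`. -/
theorem exists_isotypic_stabilizer [Fintype Γ] (τ : Γ →* Matrix ι ι ℝ) {H K : Subgroup Γ}
    (hfix : ∀ g, (∀ v ∈ isotypic τ H K, τ g *ᵥ v = v) → g ∈ K)
    (hne : ∃ v ∈ isotypic τ H K, v ≠ 0) :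
    ∃ v ∈ isotypic τ H K, v ≠ 0 ∧ ∀ g, τ g *ᵥ v = v → g ∈ K := by
  let E := isotypic τ H K
  -- A real vector space is not a finite union of proper subspaces. The value ⊥ for g in K is there
  -- to keep v away from 0.
  let F : Γ → Submodule ℝ E := fun g =>
    if g ∈ K then ⊥ else LinearMap.ker ((mulVecLin (τ g) - LinearMap.id).comp E.subtype)
  have hF : ∀ g, F g ≠ ⊤ := by
    intro g hg
    by_cases hk : g ∈ K
    · obtain ⟨v, hv, hv0⟩ := hne
      have : (⟨v, hv⟩ : E) ∈ F g := by rw [hg]; trivial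
      simp only [F, hk, if_true, Submodule.mem_bot] at this
      exact hv0 (congrArg Subtype.val this)
    · refine hk (hfix g fun v hv => ?_)
      have : (⟨v, hv⟩ : E) ∈ F g := by rw [hg]; trivial
      simpa [F, hk, sub_eq_zero] using this
  have hU : (⋃ p ∈ Finset.univ.image F, (p : Set E)) ≠ Set.univ := by
    refine Subspace.biUnion_ne_univ_of_top_notMem fun h => ?_
    obtain ⟨g, -, hg⟩ := Finset.mem_image.mp h
    exact hF g hg
  obtain ⟨v, hv⟩ := (Set.ne_univ_iff_exists_notMem _).mp hU
  have hv : ∀ g, v ∉ F g := fun g hg => hv (Set.mem_iUnion₂.mpr ⟨F g, by simp, hg⟩)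
  refine ⟨v, v.2, fun h0 => ?_, fun g hg => ?_⟩
  · apply hv 1
    have : v = 0 := Subtype.ext h0
    rw [this]; exact zero_mem _
  · by_contra hk
    exact hv g (by simp [F, hk, hg])

end Isotypic

/-! ### Single-channel decompositions -/

section Decomposition

variable {Γ : Type*} [Group Γ] [Fintype Γ] {ι : Type*} [Fintype ι] [DecidableEq ι]
  {n : ℕ} {ρ : SignedPermRep Γ (Fin n)}

theorem Decomposition.toHom_apply (D : Decomposition ρ) (g : Γ) (j : Fin D.r)
    (y : Γ ⧸ (D.irr j).H) (b : Fin n) :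
    ρ.toHom g (D.labels ⟨j, g • y⟩) b = if b = D.labels ⟨j, y⟩ then
      sgn (D.irr j).K (((D.irr j).transversal (g • y))⁻¹ * (g * (D.irr j).transversal y))
      else 0 := by
  obtain ⟨⟨k, z⟩, rfl⟩ := D.labels.surjective b
  rw [D.eq_directSum, reindex_apply, submatrix_apply, Equiv.symm_apply_apply,
    Equiv.symm_apply_apply, blockDiagonal'_apply]
  by_cases hjk : j = k
  · subst hjk
    by_cases hz : z = y
    · subst hz
      simp [IrrepData.rep, IrrepData.mat]
    · have hz' : ¬ g • y = g • z := fun h => hz (MulAction.injective g h).symm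
      simp [IrrepData.rep, IrrepData.mat, hz, hz']
  · have : ¬ k = j := fun h => hjk h.symm
    simp [hjk, this]

theorem Decomposition.permPart_apply (D : Decomposition ρ) (g : Γ) (j : Fin D.r)
    (y : Γ ⧸ (D.irr j).H) (b : Fin n) :
    ρ.permPart g (D.labels ⟨j, g • y⟩) b = if b = D.labels ⟨j, y⟩ then 1 else 0 := by
  rw [SignedPermRep.permPart, map_apply, D.toHom_apply]
  simp only [sgn]
  split_ifs <;> simp

theorem Decomposition.toHom_mul_row (D : Decomposition ρ) {κ : Type*} (V : Matrix (Fin n) κ ℝ)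
    (g : Γ) (j : Fin D.r) (y : Γ ⧸ (D.irr j).H) :
    (ρ.toHom g * V) (D.labels ⟨j, g • y⟩) =
      sgn (D.irr j).K (((D.irr j).transversal (g • y))⁻¹ * (g * (D.irr j).transversal y)) •
        V (D.labels ⟨j, y⟩) := by
  ext c
  simp [Matrix.mul_apply, D.toHom_apply]

theorem Decomposition.permPart_mulVec (D : Decomposition ρ) (u : Fin n → ℝ)
    (g : Γ) (j : Fin D.r) (y : Γ ⧸ (D.irr j).H) :
    (ρ.permPart g *ᵥ u) (D.labels ⟨j, g • y⟩) = u (D.labels ⟨j, y⟩) := by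
  simp [mulVec, dotProduct, D.permPart_apply]

theorem Decomposition.intertwines_iff_rows (D : Decomposition ρ) {τ : Γ →* Matrix ι ι ℝ}
    (hτ : ∀ g, (τ g)ᵀ = τ g⁻¹) (V : Matrix (Fin n) ι ℝ) (g : Γ) :
    ρ.toHom g * V = V * τ g ↔ ∀ j (y : Γ ⧸ (D.irr j).H), V (D.labels ⟨j, g • y⟩) =
      sgn (D.irr j).K (((D.irr j).transversal (g • y))⁻¹ * (g * (D.irr j).transversal y)) •
        τ g *ᵥ V (D.labels ⟨j, y⟩) := by
  have hrow : ∀ a, (V * τ g) a = τ g⁻¹ *ᵥ V a := fun a => by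
    rw [← vecMul_eq_inv_mulVec hτ]; rfl
  constructor
  · intro h j y
    have h1 := congrFun h (D.labels ⟨j, g • y⟩)
    rw [D.toHom_mul_row, hrow] at h1
    rw [(hom_inv_mulVec_eq_iff τ g _ _).mp h1.symm, mulVec_smul]
  · intro h
    funext a
    obtain ⟨⟨j, x⟩, rfl⟩ := D.labels.surjective a
    obtain ⟨y, rfl⟩ := MulAction.surjective g x
    rw [D.toHom_mul_row, hrow, eq_comm, hom_inv_mulVec_eq_iff, h, mulVec_smul]

/-- Frobenius reciprocity: an intertwiner into `ρ` is given by one isotypic vector per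
summand. -/
theorem Decomposition.intertwines_iff (D : Decomposition ρ) {τ : Γ →* Matrix ι ι ℝ}
    (hτ : ∀ g, (τ g)ᵀ = τ g⁻¹) (V : Matrix (Fin n) ι ℝ) :
    (∀ g, ρ.toHom g * V = V * τ g) ↔ ∃ v : Fin D.r → ι → ℝ,
      (∀ j, v j ∈ isotypic τ (D.irr j).H (D.irr j).K) ∧
      ∀ j x, V (D.labels ⟨j, x⟩) = τ ((D.irr j).transversal x) *ᵥ v j := by
  simp only [D.intertwines_iff_rows hτ]
  constructor
  · intro h
    let o : ∀ j, Γ ⧸ (D.irr j).H := fun j => ((1 : Γ) : Γ ⧸ (D.irr j).H)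
    -- For a in H, the element t_x a t_y⁻¹ carries y to x with cocycle value exactly a. Taking x = y
    -- = o gives isotypy; taking a = 1, y = o gives the row formula.
    have hmove : ∀ j (a : Γ) (y x : Γ ⧸ (D.irr j).H),
        ((D.irr j).transversal x * a * ((D.irr j).transversal y)⁻¹) • y = x →
        V (D.labels ⟨j, x⟩) = sgn (D.irr j).K a •
          τ ((D.irr j).transversal x * a * ((D.irr j).transversal y)⁻¹) *ᵥ
            V (D.labels ⟨j, y⟩) := by
      intro j a y x hx
      have := h ((D.irr j).transversal x * a * ((D.irr j).transversal y)⁻¹) j y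
      rw [hx] at this
      rw [this]
      congr 2
      group
    have hcoset : ∀ j (a : Γ) (y x : Γ ⧸ (D.irr j).H), a ∈ (D.irr j).H →
        ((D.irr j).transversal x * a * ((D.irr j).transversal y)⁻¹) • y = x := by
      intro j a y x ha
      have aux : ∀ s t : Γ, (s * a * t⁻¹) • (t : Γ ⧸ (D.irr j).H) = s := fun s t => by
        rw [MulAction.Quotient.smul_coe, smul_eq_mul, inv_mul_cancel_right, eq_comm,
          QuotientGroup.eq, inv_mul_cancel_left]
        exact ha
      have := aux ((D.irr j).transversal x) ((D.irr j).transversal y)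
      rwa [(D.irr j).transversal_spec, (D.irr j).transversal_spec] at this
    -- The inverse translate is needed because the transversal may represent the trivial coset by an
    -- element other than 1.
    refine ⟨fun j => τ ((D.irr j).transversal (o j))⁻¹ *ᵥ V (D.labels ⟨j, o j⟩), ?_, ?_⟩
    · intro j a ha
      have := hmove j a (o j) (o j) (hcoset j a _ _ ha)
      rw [← hom_mulVec_mul, eq_comm, ← mulVec_smul, hom_inv_mulVec_eq_iff, ← hom_mulVec_mul,
        ← mul_assoc]
      conv_lhs => rw [this]
      rw [smul_smul, sgn_mul_self, one_smul]
    · intro j x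
      have := hmove j 1 (o j) x (hcoset j 1 _ _ (one_mem _))
      rw [sgn_one, one_smul, mul_one] at this
      rw [← hom_mulVec_mul]
      exact this
  · rintro ⟨v, hv, hV⟩ g j y
    rw [hV, hV, ← hom_mulVec_mul]
    have h1 := hv j _ ((D.irr j).mem_H g y)
    rw [hom_mulVec_mul, hom_inv_mulVec_eq_iff, mulVec_smul] at h1
    rw [h1, smul_smul, sgn_mul_self, one_smul]

/-- Conjugate pairs of subgroups give equivalent representations. -/
theorem IrrepData.equivalent_of_conj (p q : IrrepData Γ) (g : Γ)
    (hH : ∀ h, h ∈ q.H ↔ g⁻¹ * h * g ∈ p.H) (hK : ∀ h, h ∈ q.K ↔ g⁻¹ * h * g ∈ p.K) :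
    p.rep.Equivalent q.rep := by
  -- Since q.H = g p.H g⁻¹, the map aH ↦ ag⁻¹(q.H) is a well-defined equivariant bijection; ε below
  -- corrects for the two choices of transversal.
  let f : Γ ⧸ p.H ≃ Γ ⧸ q.H := Quotient.congr (Equiv.mulRight g⁻¹) fun a b => by
    simp only [← Quotient.eq_iff_equiv]
    change ((a : Γ ⧸ p.H) = b) ↔ (((a * g⁻¹ : Γ) : Γ ⧸ q.H) = (b * g⁻¹ : Γ))
    rw [QuotientGroup.eq, QuotientGroup.eq, hH]
    group
  have hf : ∀ a : Γ, f (a : Γ ⧸ p.H) = ((a * g⁻¹ : Γ) : Γ ⧸ q.H) := fun a => rfl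
  have hft : ∀ x, f x = ((p.transversal x * g⁻¹ : Γ) : Γ ⧸ q.H) := fun x => by
    rw [← hf, p.transversal_spec]
  have hsmul : ∀ (γ : Γ) x, f (γ • x) = γ • f x := by
    intro γ x
    rw [hft x, ← p.transversal_spec x]
    change f ((γ * _ : Γ) : Γ ⧸ p.H) = ((γ * _ : Γ) : Γ ⧸ q.H)
    rw [hf, p.transversal_spec, mul_assoc]
  have hmem : ∀ x, (q.transversal (f x))⁻¹ * (p.transversal x * g⁻¹) ∈ q.H := fun x => by
    rw [← QuotientGroup.eq, q.transversal_spec, hft]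
  let ε : Γ ⧸ p.H → ℝ := fun x => sgn q.K ((q.transversal (f x))⁻¹ * (p.transversal x * g⁻¹))
  refine ⟨Matrix.of fun a x => if a = f x then ε x else 0, ⟨f, ε, fun x => ?_, fun a x => ?_⟩,
    fun γ => ?_⟩
  · simp only [ε, sgn]; split_ifs <;> simp
  · by_cases h : a = f x <;> simp [h]
  have hsgn : ∀ a, sgn p.K a = sgn q.K (g * a * g⁻¹) := fun a => by
    simp only [sgn, hK]
    congr 2
    group
  -- Both sides are the sign of t_q(γ f x)⁻¹ γ t_p(x) g⁻¹.
  have key : ∀ x, sgn q.K ((q.transversal (γ • f x))⁻¹ * (γ * q.transversal (f x))) * ε x =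
      ε (γ • x) * sgn p.K ((p.transversal (γ • x))⁻¹ * (γ * p.transversal x)) := by
    intro x
    have hmem' : g * ((p.transversal (γ • x))⁻¹ * (γ * p.transversal x)) * g⁻¹ ∈ q.H := by
      rw [hH]
      convert p.mem_H γ x using 1
      group
    rw [hsgn]
    simp only [ε]
    rw [← sgn_mul q.relIndex_le (q.mem_H γ (f x)) (hmem x),
      ← sgn_mul q.relIndex_le (hmem (γ • x)) hmem', hsmul]
    congr 1
    group
  ext a x
  rw [Matrix.mul_apply, Matrix.mul_apply, Finset.sum_eq_single (f x), Finset.sum_eq_single (γ • x)]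
  · by_cases ha : a = γ • f x
    · subst ha
      simpa [IrrepData.rep, IrrepData.mat, hsmul] using key x
    · simp [IrrepData.rep, IrrepData.mat, hsmul, ha]
  · intro z _ hz
    simp [IrrepData.rep, IrrepData.mat, hz]
  · simp
  · intro z _ hz
    simp [hz]
  · simp

end Decomposition

/-! ### The permutation part -/

section PermPart

variable {Γ : Type*} [Group Γ] {ι : Type*} [Fintype ι] [DecidableEq ι]

theorem IsSignedPermMatrix.transpose_mul_self {A : Matrix ι ι ℝ} (h : IsSignedPermMatrix A) :
    Aᵀ * A = 1 := by
  obtain ⟨e, ε, hε, hA⟩ := h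
  ext a b
  rw [Matrix.mul_apply, Finset.sum_eq_single (e a)]
  · rw [transpose_apply, hA, hA, Matrix.one_apply]
    rcases hε a with h | h <;> by_cases hab : a = b <;> simp [hab, h] <;> subst hab <;> simp [h]
  · intro c _ hc
    simp [hA, hc]
  · simp

theorem SignedPermRep.transpose_toHom (ρ : SignedPermRep Γ ι) (g : Γ) :
    (ρ.toHom g)ᵀ = ρ.toHom g⁻¹ := by
  have h1 : ρ.toHom g * ρ.toHom g⁻¹ = 1 := by rw [← map_mul, mul_inv_cancel, map_one]
  rw [← Matrix.mul_one (ρ.toHom g)ᵀ, ← h1, ← Matrix.mul_assoc, (ρ.signed g).transpose_mul_self,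
    Matrix.one_mul]

/-- The permutation part as a representation. -/
def SignedPermRep.permHom (ρ : SignedPermRep Γ ι) : Γ →* Matrix ι ι ℝ where
  toFun := ρ.permPart
  map_one' := by
    ext a b
    simp only [SignedPermRep.permPart, map_one, map_apply, Matrix.one_apply]
    split_ifs <;> simp
  map_mul' g h := by
    -- A column of ρ(h) has one nonzero entry, so each entry of the product is a single term and
    -- absolute values multiply.
    obtain ⟨e, ε, -, hA⟩ := ρ.signed h
    ext a b
    have h1 : ∀ c, c ≠ e b → ρ.toHom h c b = 0 := fun c hc => by rw [hA, if_neg hc]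
    simp only [SignedPermRep.permPart, map_mul, map_apply, Matrix.mul_apply]
    rw [Finset.sum_eq_single (e b), Finset.sum_eq_single (e b), abs_mul]
    · intro c _ hc; simp [h1 c hc]
    · simp
    · intro c _ hc; simp [h1 c hc]
    · simp

theorem SignedPermRep.permHom_apply (ρ : SignedPermRep Γ ι) (g : Γ) :
    ρ.permHom g = ρ.permPart g := rfl

theorem SignedPermRep.transpose_permHom (ρ : SignedPermRep Γ ι) (g : Γ) :
    (ρ.permHom g)ᵀ = ρ.permHom g⁻¹ := by
  rw [permHom_apply, permHom_apply, permPart, permPart, ← ρ.transpose_toHom, transpose_map]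

end PermPart

/-! ### The groups θ and the permutation part -/

section Theta

variable {Γ : Type*} [Group Γ] [Fintype Γ]

theorem cosetRep_mulVec (J : Subgroup Γ) (g : Γ) (u : Γ ⧸ J → ℝ) (y : Γ ⧸ J) :
    (cosetRep J g *ᵥ u) (g • y) = u y := by
  rw [mulVec, dotProduct, Finset.sum_eq_single y]
  · simp [cosetRep]
  · intro z _ hz
    have : ¬ g • y = g • z := fun h => hz (MulAction.injective g h).symm
    simp [cosetRep, this]
  · simp

/-- An element lies in all the groups `θ(H, K, H_j)` iff it fixes the isotypic vectors of the
permutation part. -/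
theorem Decomposition.mem_iInf_theta_iff {n : ℕ} {ρ : SignedPermRep Γ (Fin n)}
    (D : Decomposition ρ) {H K : Subgroup Γ} (hle : K ≤ H) (hi : K.relIndex H ≤ 2) (g : Γ) :
    g ∈ ⨅ j : Fin D.r, theta H K (D.irr j).H ↔
      ∀ u ∈ isotypic ρ.permHom H K, ρ.permHom g *ᵥ u = u := by
  let block : ∀ j, (Fin n → ℝ) → Γ ⧸ (D.irr j).H → ℝ := fun j u x => u (D.labels ⟨j, x⟩)
  have hblock : ∀ j h u, block j (ρ.permHom h *ᵥ u) = cosetRep _ h *ᵥ block j u := by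
    intro j h u
    ext x
    obtain ⟨y, rfl⟩ := MulAction.surjective h x
    rw [cosetRep_mulVec]
    exact D.permPart_mulVec u h j y
  have hext : ∀ u w, (∀ j, block j u = block j w) → u = w := by
    intro u w h
    ext a
    obtain ⟨⟨j, x⟩, rfl⟩ := D.labels.surjective a
    exact congrFun (h j) x
  simp only [Subgroup.mem_iInf, theta, mem_stabProj_iff _ hle hi]
  constructor
  · intro h u hu
    refine hext _ _ fun j => ?_
    rw [hblock, h j]
    intro a ha
    rw [← hblock, hu a ha]
    rfl
  · intro h j w hw
    -- Extension of w by zero to the other summands.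
    let u : Fin n → ℝ := fun a =>
      (Pi.single j w : ∀ k, Γ ⧸ (D.irr k).H → ℝ) (D.labels.symm a).1 (D.labels.symm a).2
    have hu : ∀ k, block k u = (Pi.single j w : ∀ k, Γ ⧸ (D.irr k).H → ℝ) k := by
      intro k
      ext x
      simp only [block, u]
      rw [Equiv.symm_apply_apply]
    have hfix := h u fun a ha => by
      refine hext _ _ fun k => ?_
      have hs : block k (sgn K a • u) = sgn K a • block k u := rfl
      rw [hblock, hs, hu]
      by_cases hk : k = j
      · subst hk
        rw [Pi.single_eq_same, hw a ha]
      · rw [Pi.single_eq_of_ne hk, mulVec_zero, smul_zero]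
    have := congrArg (block j) hfix
    rwa [hblock, hu, Pi.single_eq_same] at this

end Theta

/-! ### The block diagonal representation on the inputs of a layer -/

instance Inputs.decidableEq (m : ℕ) (n : ℕ → ℕ) : ∀ i, DecidableEq (Inputs m n i)
  | 0 => inferInstanceAs (DecidableEq (Fin m))
  | i + 1 => @instDecidableEqSum _ _ (inferInstanceAs (DecidableEq (Fin (n i))))
      (Inputs.decidableEq m n i)

section Network

variable {m : ℕ} {G : Subgroup (Matrix.orthogonalGroup (Fin m) ℝ)} {L : ℕ}

theorem transpose_defRep (g : G) : (defRep G g)ᵀ = defRep G g⁻¹ := rfl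

/-- The direct sum of two matrix representations. -/
def directSum {Γ : Type*} [Group Γ] {ι κ : Type*} [Fintype ι] [DecidableEq ι]
    [Fintype κ] [DecidableEq κ]
    (σ : Γ →* Matrix ι ι ℝ) (τ : Γ →* Matrix κ κ ℝ) :
    Γ →* Matrix (ι ⊕ κ) (ι ⊕ κ) ℝ where
  toFun g := fromBlocks (σ g) 0 0 (τ g)
  map_one' := by
    rw [map_one, map_one]
    exact fromBlocks_one
  map_mul' g h := by simp [fromBlocks_multiply]

theorem directSum_apply {Γ : Type*} [Group Γ] {ι κ : Type*} [Fintype ι] [DecidableEq ι]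
    [Fintype κ] [DecidableEq κ]
    (σ : Γ →* Matrix ι ι ℝ) (τ : Γ →* Matrix κ κ ℝ) (g : Γ) :
    directSum σ τ g = fromBlocks (σ g) 0 0 (τ g) := rfl

theorem directSum_mulVec {Γ : Type*} [Group Γ] {ι κ : Type*} [Fintype ι] [DecidableEq ι]
    [Fintype κ] [DecidableEq κ]
    (σ : Γ →* Matrix ι ι ℝ) (τ : Γ →* Matrix κ κ ℝ) (g : Γ) (u : ι → ℝ) (w : κ → ℝ) :
    directSum σ τ g *ᵥ Sum.elim u w = Sum.elim (σ g *ᵥ u) (τ g *ᵥ w) := by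
  rw [directSum_apply, fromBlocks_mulVec]
  simp

theorem elim_mem_isotypic_directSum {Γ : Type*} [Group Γ] {ι κ : Type*} [Fintype ι] [DecidableEq ι]
    [Fintype κ] [DecidableEq κ]
    {σ : Γ →* Matrix ι ι ℝ} {τ : Γ →* Matrix κ κ ℝ} {H K : Subgroup Γ} {u : ι → ℝ} {w : κ → ℝ} :
    Sum.elim u w ∈ isotypic (directSum σ τ) H K ↔ u ∈ isotypic σ H K ∧ w ∈ isotypic τ H K := by
  have hs : ∀ c : ℝ, c • Sum.elim u w = Sum.elim (c • u) (c • w) := fun c => by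
    ext (a | a) <;> rfl
  simp only [mem_isotypic, directSum_mulVec, hs, Sum.elim_eq_iff]
  exact ⟨fun h => ⟨fun a ha => (h a ha).1, fun a ha => (h a ha).2⟩,
    fun h a ha => ⟨h.1 a ha, h.2 a ha⟩⟩

theorem transpose_directSum {Γ : Type*} [Group Γ] {ι κ : Type*} [Fintype ι] [DecidableEq ι]
    [Fintype κ] [DecidableEq κ] {σ : Γ →* Matrix ι ι ℝ} {τ : Γ →* Matrix κ κ ℝ} {g : Γ}
    (hσ : (σ g)ᵀ = σ g⁻¹) (hτ : (τ g)ᵀ = τ g⁻¹) : (directSum σ τ g)ᵀ = directSum σ τ g⁻¹ := by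
  rw [directSum_apply, directSum_apply, fromBlocks_transpose, hσ, hτ, transpose_zero,
    transpose_zero]

/-- The vectors fixed by `g` include the isotypic vectors of a direct sum iff they include
those of the summands. -/
theorem forall_isotypic_directSum_iff {Γ : Type*} [Group Γ] {ι κ : Type*} [Fintype ι]
    [DecidableEq ι] [Fintype κ] [DecidableEq κ] (σ : Γ →* Matrix ι ι ℝ) (τ : Γ →* Matrix κ κ ℝ)
    (H K : Subgroup Γ) (g : Γ) :
    (∀ v ∈ isotypic (directSum σ τ) H K, directSum σ τ g *ᵥ v = v) ↔
      (∀ w ∈ isotypic τ H K, τ g *ᵥ w = w) ∧ ∀ u ∈ isotypic σ H K, σ g *ᵥ u = u := by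
  constructor
  · intro h
    refine ⟨fun w hw => ?_, fun u hu => ?_⟩
    · have := h (Sum.elim 0 w) (elim_mem_isotypic_directSum.mpr ⟨zero_mem _, hw⟩)
      rw [directSum_mulVec] at this
      exact (Sum.elim_eq_iff.mp this).2
    · have := h (Sum.elim u 0) (elim_mem_isotypic_directSum.mpr ⟨hu, zero_mem _⟩)
      rw [directSum_mulVec] at this
      exact (Sum.elim_eq_iff.mp this).1
  · rintro ⟨h1, h2⟩ v hv
    obtain ⟨u, w, rfl⟩ : ∃ u w, v = Sum.elim u w :=
      ⟨v ∘ Sum.inl, v ∘ Sum.inr, (Sum.elim_comp_inl_inr v).symm⟩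
    obtain ⟨hu, hw⟩ := elim_mem_isotypic_directSum.mp hv
    rw [directSum_mulVec, h1 w hw, h2 u hu]

/-- The block diagonal representation on the inputs of layer `i`. -/
def inputRep (A : Architecture G L) : ∀ i, G →* Matrix (Inputs m A.width i) (Inputs m A.width i) ℝ
  | 0 => defRep G
  | i + 1 => directSum (A.rep i).permHom (inputRep A i)

theorem transpose_inputRep (A : Architecture G L) (i : ℕ) (g : G) :
    (inputRep A i g)ᵀ = inputRep A i g⁻¹ := by
  induction i with
  | zero => exact transpose_defRep g
  | succ i ih =>
    exact transpose_directSum ((A.rep i).transpose_permHom g) ih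

/-- `φ` of layer `i` is the pointwise stabilizer of the isotypic vectors. -/
theorem mem_phi_iff [Fintype G] {A : Architecture G L} (D : ∀ i, Decomposition (A.rep i)) (i : ℕ)
    {H K : Subgroup G} (hle : K ≤ H) (hi : K.relIndex H ≤ 2) (g : G) :
    g ∈ phi D i H K ↔ ∀ v ∈ isotypic (inputRep A i) H K, inputRep A i g *ᵥ v = v := by
  induction i with
  | zero => exact mem_stabProj_iff (defRep G) hle hi g
  | succ i ih =>
    rw [phi, Subgroup.mem_inf, ih, (D i).mem_iInf_theta_iff hle hi]
    exact (forall_isotypic_directSum_iff _ _ H K g).symm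

/-- `K` lies in `φ(H, K)`. -/
theorem le_phi [Fintype G] {A : Architecture G L} (D : ∀ i, Decomposition (A.rep i)) (i : ℕ)
    {H K : Subgroup G} (hle : K ≤ H) (hi : K.relIndex H ≤ 2) : K ≤ phi D i H K := by
  intro k hk
  rw [mem_phi_iff D i hle hi]
  intro v hv
  rw [hv k (hle hk), sgn_of_mem hk, one_smul]

/-! ### Diagonalizing `ψ` -/

/-- The change of basis turning `ψ` into the block diagonal representation. -/
def toDiag {n : ℕ → ℕ} (W : ∀ i, Matrix (Fin (n i)) (Inputs m n i) ℝ) :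
    ∀ i, Matrix (Inputs m n i) (Inputs m n i) ℝ
  | 0 => 1
  | i + 1 => fromBlocks (1 : Matrix (Fin (n i)) (Fin (n i)) ℝ)
      (-((1 / 2 : ℝ) • W i)) 0 (toDiag W i)

/-- The inverse of `toDiag`. -/
def ofDiag {n : ℕ → ℕ} (W : ∀ i, Matrix (Fin (n i)) (Inputs m n i) ℝ) :
    ∀ i, Matrix (Inputs m n i) (Inputs m n i) ℝ
  | 0 => 1
  | i + 1 => fromBlocks (1 : Matrix (Fin (n i)) (Fin (n i)) ℝ)
      ((1 / 2 : ℝ) • (W i * ofDiag W i)) 0 (ofDiag W i)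

theorem fromBlocks_mul_unipotent {ι κ : Type*} [Fintype ι] [DecidableEq ι] [Fintype κ]
    [DecidableEq κ] (X : Matrix ι κ ℝ) {S T : Matrix κ κ ℝ} (h : S * T = 1) :
    fromBlocks (1 : Matrix ι ι ℝ) ((1 / 2 : ℝ) • (X * S)) 0 S *
      fromBlocks (1 : Matrix ι ι ℝ) (-((1 / 2 : ℝ) • X)) 0 T = 1 := by
  rw [fromBlocks_multiply]
  simp [Matrix.mul_assoc, h]

/-- In the upper right block the two terms ½πXS cancel, leaving ½XΨS = ½XSτ. -/
theorem fromBlocks_psi_mul {ι κ : Type*} [Fintype ι] [DecidableEq ι] [Fintype κ]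
    [DecidableEq κ] (π : Matrix ι ι ℝ) (X : Matrix ι κ ℝ) {S Ψ τ : Matrix κ κ ℝ}
    (h : Ψ * S = S * τ) :
    fromBlocks π ((1 / 2 : ℝ) • (X * Ψ - π * X)) 0 Ψ *
        fromBlocks (1 : Matrix ι ι ℝ) ((1 / 2 : ℝ) • (X * S)) 0 S =
      fromBlocks (1 : Matrix ι ι ℝ) ((1 / 2 : ℝ) • (X * S)) 0 S * fromBlocks π 0 0 τ := by
  rw [fromBlocks_multiply, fromBlocks_multiply]
  simp only [Matrix.smul_mul, Matrix.mul_smul, Matrix.sub_mul, Matrix.mul_assoc, h,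
    Matrix.mul_zero, Matrix.zero_mul, Matrix.one_mul, Matrix.mul_one, add_zero, zero_add,
    smul_zero]
  congr 1
  rw [smul_sub]
  abel

theorem ofDiag_mul_toDiag {n : ℕ → ℕ} (W : ∀ i, Matrix (Fin (n i)) (Inputs m n i) ℝ) (i : ℕ) :
    ofDiag W i * toDiag W i = 1 := by
  induction i with
  | zero => exact Matrix.mul_one _
  | succ i ih => exact fromBlocks_mul_unipotent (W i) ih

theorem toDiag_mul_ofDiag {n : ℕ → ℕ} (W : ∀ i, Matrix (Fin (n i)) (Inputs m n i) ℝ) (i : ℕ) :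
    toDiag W i * ofDiag W i = 1 :=
  mul_eq_one_comm.mp (ofDiag_mul_toDiag W i)

theorem psi_mul_ofDiag (A : Architecture G L) (P : Params m A.width) (g : G) (i : ℕ) :
    psi A P g i * ofDiag P.W i = ofDiag P.W i * inputRep A i g := by
  induction i with
  | zero => exact (Matrix.mul_one (defRep G g)).trans (Matrix.one_mul _).symm
  | succ i ih => exact fromBlocks_psi_mul _ (P.W i) ih

/-- The equivariance constraint in the diagonalizing basis. -/
theorem weight_iff (A : Architecture G L) (P : Params m A.width) (g : G) (i : ℕ) :
    (A.rep i).toHom g * P.W i = P.W i * psi A P g i ↔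
      (A.rep i).toHom g * (P.W i * ofDiag P.W i) = P.W i * ofDiag P.W i * inputRep A i g := by
  rw [Matrix.mul_assoc, ← psi_mul_ofDiag, ← Matrix.mul_assoc, ← Matrix.mul_assoc]
  constructor
  · intro h; rw [h]
  · intro h
    have := congrArg (· * toDiag P.W i) h
    simpa only [Matrix.mul_assoc, ofDiag_mul_toDiag, Matrix.mul_one] using this

/-- The inverse change of basis in terms of the transformed weights. -/
def toDiagOf {n : ℕ → ℕ} (V : ∀ i, Matrix (Fin (n i)) (Inputs m n i) ℝ) :
    ∀ i, Matrix (Inputs m n i) (Inputs m n i) ℝ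
  | 0 => 1
  | i + 1 => fromBlocks (1 : Matrix (Fin (n i)) (Fin (n i)) ℝ)
      (-((1 / 2 : ℝ) • (V i * toDiagOf V i))) 0 (toDiagOf V i)

/-- Weights with prescribed values in the diagonalizing basis. -/
theorem exists_weights {n : ℕ → ℕ} (V : ∀ i, Matrix (Fin (n i)) (Inputs m n i) ℝ) :
    ∃ W : ∀ i, Matrix (Fin (n i)) (Inputs m n i) ℝ, ∀ i, W i * ofDiag W i = V i := by
  refine ⟨fun i => V i * toDiagOf V i, fun i => ?_⟩
  -- `toDiag` at i involves only weights of layers before i, so the recursion defining `toDiagOf`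
  -- from V computes it.
  have : ∀ i, toDiag (fun i => V i * toDiagOf V i) i = toDiagOf V i := by
    intro i
    induction i with
    | zero => rfl
    | succ i ih => rw [toDiag, toDiagOf, ih]
  change V i * toDiagOf V i * _ = _
  rw [← this, Matrix.mul_assoc, toDiag_mul_ofDiag, Matrix.mul_one]

/-! ### Invariance -/

/-- ReLU(t) = (t + |t|)/2, and taking absolute values turns ρ into its permutation part: |ρz| =
π|z|. -/
theorem relu_signedPerm {n : ℕ} {ρ : Matrix (Fin n) (Fin n) ℝ} (hρ : IsSignedPermMatrix ρ)
    (z : Fin n → ℝ) (a : Fin n) :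
    max 0 ((ρ *ᵥ z) a) = (1 / 2 : ℝ) * ((ρ *ᵥ z) a + (ρ.map (fun x => |x|) *ᵥ fun c => |z c|) a) := by
  obtain ⟨e, ε, hε, hA⟩ := hρ
  have hz : ∀ c, c ≠ e.symm a → ρ a c = 0 := fun c hc => by
    rw [hA, if_neg]; rintro rfl; simp at hc
  have h1 : (ρ *ᵥ z) a = ε (e.symm a) * z (e.symm a) := by
    rw [mulVec, dotProduct, Finset.sum_eq_single (e.symm a)]
    · simp [hA]
    · intro c _ hc; simp [hz c hc]
    · simp
  have h2 : (ρ.map (fun x => |x|) *ᵥ fun c => |z c|) a = |z (e.symm a)| := by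
    rw [mulVec, dotProduct, Finset.sum_eq_single (e.symm a)]
    · rcases hε (e.symm a) with h | h <;> simp [hA, h]
    · intro c _ hc; simp [hz c hc]
    · simp
  have h3 : |ε (e.symm a) * z (e.symm a)| = |z (e.symm a)| := by
    rw [abs_mul]
    rcases hε (e.symm a) with h | h <;> simp [h]
  rw [h1, h2, ← h3]
  rcases le_total 0 (ε (e.symm a) * z (e.symm a)) with h | h
  · rw [max_eq_right h, abs_of_nonneg h]; ring
  · rw [max_eq_left h, abs_of_nonpos h]; ring

theorem relu_eq {z : ℝ} : max 0 z = (1 / 2 : ℝ) * (z + |z|) := by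
  rcases le_total 0 z with h | h
  · rw [max_eq_right h, abs_of_nonneg h]; ring
  · rw [max_eq_left h, abs_of_nonpos h]; ring

/-- ReLU(ρz) - π ReLU(z) = ½(ρz - πz). As ρ and π both fix b and ρX = XΨ, this is ½(XΨ - πX)f, the
off-diagonal block of `psi`. -/
theorem layer_equivariant {n : ℕ} {Γ κ : Type*} [Group Γ] [Fintype κ]
    (ρ : SignedPermRep Γ (Fin n)) (g : Γ) {X : Matrix (Fin n) κ ℝ} {b : Fin n → ℝ}
    {Ψ : Matrix κ κ ℝ} (hX : ρ.toHom g * X = X * Ψ) (hb : ρ.toHom g *ᵥ b = b)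
    (hπ : ρ.permPart g *ᵥ b = b) (f : κ → ℝ) :
    Sum.elim (fun a => max 0 ((X *ᵥ (Ψ *ᵥ f)) a + b a)) (Ψ *ᵥ f) =
      fromBlocks (ρ.permPart g) ((1 / 2 : ℝ) • (X * Ψ - ρ.permPart g * X)) 0 Ψ *ᵥ
        Sum.elim (fun a => max 0 ((X *ᵥ f) a + b a)) f := by
  obtain ⟨z, hz⟩ : ∃ z, z = X *ᵥ f + b := ⟨_, rfl⟩
  have h1 : X *ᵥ (Ψ *ᵥ f) + b = ρ.toHom g *ᵥ z := by
    rw [mulVec_mulVec, ← hX, hz, mulVec_add, hb, mulVec_mulVec]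
  have h2 : (fun a => max 0 ((X *ᵥ f) a + b a)) = (1 / 2 : ℝ) • (z + fun c => |z c|) := by
    rw [hz]
    exact funext fun a => relu_eq
  have h4 : ρ.toHom g *ᵥ z = (X * Ψ) *ᵥ f + b := by
    rw [hz, mulVec_add, hb, mulVec_mulVec, hX]
  have h5 : ρ.permPart g *ᵥ z = (ρ.permPart g * X) *ᵥ f + b := by
    rw [hz, mulVec_add, hπ, mulVec_mulVec]
  rw [h2, fromBlocks_mulVec, Sum.elim_comp_inl, Sum.elim_comp_inr, zero_mulVec, zero_add]
  refine Sum.elim_eq_iff.mpr ⟨?_, rfl⟩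
  ext a
  have h1' := congrFun h1 a
  rw [Pi.add_apply] at h1'
  rw [h1', relu_signedPerm (ρ.signed g) z a, h4, mulVec_smul, mulVec_add, h5, smul_mulVec,
    sub_mulVec]
  simp only [Pi.add_apply, Pi.smul_apply, Pi.sub_apply, smul_eq_mul, SignedPermRep.permPart]
  ring

theorem features_equivariant (A : Architecture G L) (P : Params m A.width)
    (hW : ∀ i ≤ L, ∀ g, (A.rep i).toHom g * P.W i = P.W i * psi A P g i)
    (hb : ∀ i ≤ L, ∀ g, ((A.rep i).toHom g).mulVec (P.b i) = P.b i)
    (hπ : ∀ i ≤ L, ∀ g, ((A.rep i).permPart g).mulVec (P.b i) = P.b i)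
    (g : G) (x : Fin m → ℝ) (i : ℕ) (hi : i ≤ L) :
    P.features (defRep G g *ᵥ x) i = psi A P g i *ᵥ P.features x i := by
  induction i with
  | zero => rfl
  | succ i ih =>
    have hi' : i ≤ L := by omega
    have h := layer_equivariant (A.rep i) g (hW i hi' g) (hb i hi' g) (hπ i hi' g)
      (P.features x i)
    rw [← ih hi'] at h
    exact h

/-- The output representation is trivial, so the last weight matrix absorbs `psi`. The condition
`hπ` is not part of `IsGDNN`; `Decomposition.bias` satisfies it. -/
theorem network_invariant (A : Architecture G L) (P : Params m A.width)
    (hW : ∀ i ≤ L, ∀ g, (A.rep i).toHom g * P.W i = P.W i * psi A P g i)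
    (hb : ∀ i ≤ L, ∀ g, ((A.rep i).toHom g).mulVec (P.b i) = P.b i)
    (hπ : ∀ i ≤ L, ∀ g, ((A.rep i).permPart g).mulVec (P.b i) = P.b i)
    (g : G) (x : Fin m → ℝ) : A.network P (defRep G g *ᵥ x) = A.network P x := by
  unfold Architecture.network Params.preactivation
  rw [features_equivariant A P hW hb hπ g x L le_rfl, mulVec_mulVec, ← hW L le_rfl g, A.rep_last,
    Matrix.one_mul]

end Network

/-! ### One layer -/

section Layer

theorem parallel_iff {κ : Type*} {u v : κ → ℝ} (hu : u ≠ 0) :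
    Parallel u v ↔ ∃ c : ℝ, c • u = v := by
  rw [Parallel, LinearIndependent.pair_iff' hu]
  push Not
  rfl

theorem augmented_smul_eq_iff {ι κ : Type*} (W : Matrix ι κ ℝ) (b : ι → ℝ) (c : ℝ) (a a' : ι) :
    c • augmented W b a = augmented W b a' ↔ c • W a = W a' ∧ c * b a = b a' := by
  constructor
  · intro h
    exact ⟨funext fun k => congrFun h (Sum.inl k), congrFun h (Sum.inr ())⟩
  · rintro ⟨h1, h2⟩
    ext (k | k)
    · exact congrFun h1 k
    · exact h2

variable {Γ : Type*} [Group Γ] [Fintype Γ] {ι : Type*} [Fintype ι] [DecidableEq ι]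
  {n : ℕ} {ρ : SignedPermRep Γ (Fin n)}

/-- An intertwiner with nonzero and nonparallel rows forces the pointwise stabilizers of the
isotypic vectors to be the subgroups `K_j`. -/
theorem Decomposition.mem_of_fixes_isotypic (D : Decomposition ρ) {τ : Γ →* Matrix ι ι ℝ}
    (hτ : ∀ g, (τ g)ᵀ = τ g⁻¹) {V : Matrix (Fin n) ι ℝ} {b : Fin n → ℝ}
    (hV : ∀ g, ρ.toHom g * V = V * τ g) (hb : ∀ g, ρ.toHom g *ᵥ b = b) (hne : ∀ a, V a ≠ 0)
    (hpar : ∀ a a' (c : ℝ), a ≠ a' → ¬ (c • V a = V a' ∧ c * b a = b a'))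
    (j : Fin D.r) (g : Γ)
    (hg : ∀ v ∈ isotypic τ (D.irr j).H (D.irr j).K, τ g *ᵥ v = v) : g ∈ (D.irr j).K := by
  obtain ⟨v, hv, hrow⟩ := (D.intertwines_iff hτ V).mp hV
  -- The bias is an intertwiner from the trivial representation, so reciprocity makes it constant on
  -- each summand.
  obtain ⟨β, hβ, hbrow⟩ := (D.intertwines_iff (τ := (1 : Γ →* Matrix Unit Unit ℝ)) (by simp)
    (replicateCol Unit b)).mp fun h => by
      rw [MonoidHom.one_apply, Matrix.mul_one, ← replicateCol_mulVec, hb]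
  have hbj : ∀ x, b (D.labels ⟨j, x⟩) = β j () := fun x => by
    have := congrFun (hbrow j x) ()
    rw [MonoidHom.one_apply, one_mulVec] at this
    exact this
  have hsb : ∀ h ∈ (D.irr j).H, sgn (D.irr j).K h * β j () = β j () := fun h hh => by
    have := congrFun (hβ j h hh) ()
    rw [MonoidHom.one_apply, one_mulVec] at this
    exact this.symm
  have hv0 : v j ≠ 0 := by
    intro h0
    apply hne (D.labels ⟨j, ((1 : Γ) : Γ ⧸ (D.irr j).H)⟩)
    rw [hrow, h0, mulVec_zero]
  have hgH : g ∈ (D.irr j).H := by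
    by_contra hgH
    have ht : ∀ a : Γ, ∃ h ∈ (D.irr j).H, (D.irr j).transversal (a : Γ ⧸ (D.irr j).H) = a * h :=
      fun a => ⟨a⁻¹ * (D.irr j).transversal a, QuotientGroup.eq.mp ((D.irr j).transversal_spec _).symm, by group⟩
    obtain ⟨h1, hh1, ht1⟩ := ht 1
    obtain ⟨h2, hh2, ht2⟩ := ht g
    -- The cosets H and gH differ, but g fixes v_j, so their rows agree up to the signs of h1 and
    -- h2, the deviations of the transversal from 1 and g.
    refine hpar (D.labels ⟨j, ((1 : Γ) : Γ ⧸ (D.irr j).H)⟩)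
      (D.labels ⟨j, (g : Γ ⧸ (D.irr j).H)⟩) (sgn (D.irr j).K h2 * sgn (D.irr j).K h1) ?_ ⟨?_, ?_⟩
    · intro h
      have h := D.labels.injective h
      simp only [Sigma.mk.injEq, heq_eq_eq, true_and, QuotientGroup.eq, inv_one, one_mul] at h
      exact hgH h
    · rw [hrow, hrow, ht1, ht2, one_mul, hom_mulVec_mul, hv j h1 hh1, hv j h2 hh2, mulVec_smul,
        hg _ (hv j), smul_smul, mul_assoc, sgn_mul_self, mul_one]
    · rw [hbj, hbj, mul_assoc, hsb h1 hh1, hsb h2 hh2]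
  by_contra hgK
  have h1 := hv j g hgH
  rw [hg _ (hv j), sgn_of_notMem hgK, neg_one_smul] at h1
  exact hv0 (self_eq_neg.mp h1)

/-- The bias that is `1` on the unsigned summands and `0` on the signed ones. -/
def Decomposition.bias (D : Decomposition ρ) (a : Fin n) : ℝ :=
  if (D.irr (D.labels.symm a).1).K = (D.irr (D.labels.symm a).1).H then 1 else 0

theorem Decomposition.bias_labels (D : Decomposition ρ) (j : Fin D.r) (x : Γ ⧸ (D.irr j).H) :
    D.bias (D.labels ⟨j, x⟩) = if (D.irr j).K = (D.irr j).H then 1 else 0 := by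
  rw [bias, Equiv.symm_apply_apply]

theorem Decomposition.toHom_mulVec_bias (D : Decomposition ρ) (g : Γ) :
    ρ.toHom g *ᵥ D.bias = D.bias := by
  ext a
  obtain ⟨⟨j, x⟩, rfl⟩ := D.labels.surjective a
  obtain ⟨y, rfl⟩ := MulAction.surjective g x
  have h := congrFun (D.toHom_mul_row (replicateCol Unit D.bias) g j y) ()
  rw [← replicateCol_mulVec] at h
  refine h.trans ?_
  rw [Pi.smul_apply, replicateCol_apply, bias_labels, bias_labels, smul_eq_mul]
  split_ifs with hKH
  · rw [sgn_of_mem (by rw [hKH]; exact (D.irr j).mem_H g y), mul_one]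
  · rw [mul_zero]

theorem Decomposition.permPart_mulVec_bias (D : Decomposition ρ) (g : Γ) :
    ρ.permPart g *ᵥ D.bias = D.bias := by
  ext a
  obtain ⟨⟨j, x⟩, rfl⟩ := D.labels.surjective a
  obtain ⟨y, rfl⟩ := MulAction.surjective g x
  rw [D.permPart_mulVec, bias_labels, bias_labels]

theorem Decomposition.permPart_mulVec_one (D : Decomposition ρ) (g : Γ) :
    ρ.permPart g *ᵥ 1 = 1 := by
  ext a
  obtain ⟨⟨j, x⟩, rfl⟩ := D.labels.surjective a
  obtain ⟨y, rfl⟩ := MulAction.surjective g x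
  exact D.permPart_mulVec 1 g j y

/-- Isotypic vectors with stabilizers `K_j` give an intertwiner with nonzero, nonparallel rows. -/
theorem Decomposition.exists_intertwiner (D : Decomposition ρ) {τ : Γ →* Matrix ι ι ℝ}
    (hτ : ∀ g, (τ g)ᵀ = τ g⁻¹)
    (h : ∀ j, ∃ v ∈ isotypic τ (D.irr j).H (D.irr j).K, v ≠ 0 ∧
      ∀ g, τ g *ᵥ v = v → g ∈ (D.irr j).K) :
    ∃ V : Matrix (Fin n) ι ℝ, (∀ g, ρ.toHom g * V = V * τ g) ∧ (∀ a, V a ≠ 0) ∧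
      ∀ a a' (c : ℝ), a ≠ a' → ¬ (c • V a = V a' ∧ c * D.bias a = D.bias a') := by
  choose v hv hv0 hstab using h
  let V : Matrix (Fin n) ι ℝ := fun a =>
    τ ((D.irr (D.labels.symm a).1).transversal (D.labels.symm a).2) *ᵥ v (D.labels.symm a).1
  have hrow : ∀ j x, V (D.labels ⟨j, x⟩) = τ ((D.irr j).transversal x) *ᵥ v j := fun j x => by
    simp only [V]
    rw [Equiv.symm_apply_apply]
  have hrow0 : ∀ a, V a ≠ 0 := by
    intro a h0
    obtain ⟨⟨j, x⟩, rfl⟩ := D.labels.surjective a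
    rw [hrow] at h0
    apply hv0 j
    rw [← (hom_inv_mulVec_eq_iff τ _ _ _).mpr h0.symm, mulVec_zero]
  refine ⟨V, (D.intertwines_iff hτ V).mpr ⟨v, hv, hrow⟩, hrow0, ?_⟩
  rintro a a' c hne ⟨hc, hcb⟩
  obtain ⟨⟨j, x⟩, rfl⟩ := D.labels.surjective a
  obtain ⟨⟨k, y⟩, rfl⟩ := D.labels.surjective a'
  have hc0 : c ≠ 0 := by
    rintro rfl
    exact hrow0 _ (by rw [← hc, zero_smul])
  rw [D.bias_labels, D.bias_labels] at hcb
  rw [hrow, hrow] at hc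
  set g := ((D.irr k).transversal y)⁻¹ * (D.irr j).transversal x with hgdef
  have hvk : v k = c • τ g *ᵥ v j := by
    rw [hgdef, hom_mulVec_mul, ← mulVec_smul, eq_comm, hom_inv_mulVec_eq_iff, hc]
  clear_value g
  by_cases hjk : j = k
  · subst hjk
    have hgH : g ∈ (D.irr j).H := by
      -- On an unsigned summand the bias 1 forces c = 1. On a signed one the bias is 0, but τ is
      -- orthogonal, so c = ±1.
      by_cases hKH : (D.irr j).K = (D.irr j).H
      · rw [if_pos hKH, mul_one] at hcb
        rw [hcb, one_smul] at hvk
        exact (D.irr j).le (hstab j g hvk.symm)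
      · have hd : c * c = 1 := by
          have h1 : v j ⬝ᵥ v j = c * (c * (v j ⬝ᵥ v j)) := by
            conv_lhs => rw [hvk]
            rw [smul_dotProduct, dotProduct_smul, dotProduct_mulVec_mulVec hτ, smul_eq_mul,
              smul_eq_mul]
          have h2 : v j ⬝ᵥ v j ≠ 0 := fun h => hv0 j (dotProduct_self_eq_zero.mp h)
          exact mul_right_cancel₀ h2 (by linarith)
        rcases mul_self_eq_one_iff.mp hd with h1 | h1
        · rw [h1, one_smul] at hvk
          exact (D.irr j).le (hstab j g hvk.symm)
        · rw [h1, neg_one_smul] at hvk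
          exact mem_of_mulVec_eq_neg (D.irr j).le hKH (hv j) (hstab j)
            (neg_eq_iff_eq_neg.mp hvk.symm)
    have hxy : y = x := by
      rw [← (D.irr j).transversal_spec y, ← (D.irr j).transversal_spec x]
      exact QuotientGroup.eq.mpr (hgdef ▸ hgH)
    exact hne (by rw [hxy])
  -- Rows of different summands: conjugation by g carries the stabilizer of v_j, and that of the
  -- pair ±v_j, to those for v_k. These recover K and, for signed summands, H. The biases rule out
  -- one signed and one unsigned summand.
  · have hact : ∀ h (e : ℝ), τ h *ᵥ v k = e • v k ↔ τ (g⁻¹ * h * g) *ᵥ v j = e • v j := by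
      intro h e
      rw [hvk, mulVec_smul, smul_comm e c, smul_right_inj hc0, mul_assoc, hom_mulVec_mul,
        hom_inv_mulVec_eq_iff, hom_mulVec_mul, mulVec_smul]
    have hfix : ∀ l h, h ∈ (D.irr l).K ↔ τ h *ᵥ v l = (1 : ℝ) • v l := by
      intro l h
      rw [one_smul]
      refine ⟨fun hh => ?_, hstab l h⟩
      rw [hv l h ((D.irr l).le hh), sgn_of_mem hh, one_smul]
    have hK : ∀ h, h ∈ (D.irr k).K ↔ g⁻¹ * h * g ∈ (D.irr j).K := fun h => by
      rw [hfix, hfix, hact]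
    refine D.inequivalent j k hjk (IrrepData.equivalent_of_conj _ _ g (fun h => ?_) hK)
    by_cases hj : (D.irr j).K = (D.irr j).H <;> by_cases hk : (D.irr k).K = (D.irr k).H
    · rw [← hj, ← hk, hK]
    · rw [if_pos hj, if_neg hk, mul_one] at hcb
      exact absurd hcb hc0
    · rw [if_neg hj, if_pos hk, mul_zero] at hcb
      exact absurd hcb zero_ne_one
    · have hH : ∀ l, (D.irr l).K ≠ (D.irr l).H → ∀ h, h ∈ (D.irr l).H ↔
          τ h *ᵥ v l = (1 : ℝ) • v l ∨ τ h *ᵥ v l = (-1 : ℝ) • v l := by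
        intro l hl h
        constructor
        · intro hh
          rw [hv l h hh, sgn]
          split_ifs <;> simp
        · rintro (h1 | h1)
          · exact (D.irr l).le ((hfix l h).mpr h1)
          · exact mem_of_mulVec_eq_neg (D.irr l).le hl (hv l) (hstab l) (h1.trans (neg_one_smul _ _))
      rw [hH k hk, hH j hj, hact, hact]

end Layer

/-! ### The two directions of the theorem -/

section Admissible

variable {m : ℕ} {G : Subgroup (Matrix.orthogonalGroup (Fin m) ℝ)} [Fintype G] {L : ℕ}

/-- If K ≠ G, an element outside K = φ(H, K) moves some isotypic vector, which is therefore nonzero.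
If K = G, `h0` serves the first layer, and later layers have the all-ones vector on the preceding
neurons. -/
theorem exists_isotypic_ne_zero (A : Architecture G L) (D : ∀ i, Decomposition (A.rep i))
    (h0 : (∃ j : Fin (D 0).r, ((D 0).irr j).H = ⊤ ∧ ((D 0).irr j).K = ⊤) →
      invProj (Set.range (defRep G)) ≠ 0) {i : ℕ} (hi : i ≤ L) (j : Fin (D i).r)
    (hphi : phi D i ((D i).irr j).H ((D i).irr j).K = ((D i).irr j).K) :
    ∃ v ∈ isotypic (inputRep A i) ((D i).irr j).H ((D i).irr j).K, v ≠ 0 := by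
  by_cases hK : ((D i).irr j).K = ⊤
  · have hH : ((D i).irr j).H = ⊤ := top_le_iff.mp (hK ▸ ((D i).irr j).le)
    rw [hK, hH]
    cases i with
    | zero => exact (invProj_range_ne_zero_iff (defRep G)).mp (h0 ⟨j, hH, hK⟩)
    | succ i =>
      refine ⟨Sum.elim 1 0, elim_mem_isotypic_directSum.mpr ⟨fun g hg => ?_, zero_mem _⟩,
        fun h => ?_⟩
      · rw [sgn_of_mem hg, one_smul]
        exact (D i).permPart_mulVec_one g
      · exact one_ne_zero (congrFun h (Sum.inl ⟨0, A.width_pos i (by omega)⟩))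
  · obtain ⟨g, hg⟩ : ∃ g, g ∉ ((D i).irr j).K := by
      by_contra! hcon
      exact hK (top_le_iff.mp fun g _ => hcon g)
    rw [← hphi, mem_phi_iff D i ((D i).irr j).le ((D i).irr j).relIndex_le] at hg
    push Not at hg
    obtain ⟨v, hv, hgv⟩ := hg
    exact ⟨v, hv, fun h => hgv (by rw [h, mulVec_zero])⟩

theorem smul_row_mul {ι κ : Type*} [Fintype κ] {W : Matrix ι κ ℝ} {a a' : ι} {c : ℝ}
    (h : c • W a = W a') (T : Matrix κ κ ℝ) : c • (W * T) a = (W * T) a' := by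
  change c • (W a ᵥ* T) = W a' ᵥ* T
  rw [← h, smul_vecMul]

/-- The row conditions pass from W to V through the invertible `toDiag`. The nonzero vector is what
condition 2 needs. -/
theorem Architecture.Admissible.phi_eq {A : Architecture G L} (hA : A.Admissible)
    (D : ∀ i, Decomposition (A.rep i)) {i : ℕ} (hi : i ≤ L) (j : Fin (D i).r) :
    (phi D i ((D i).irr j).H ((D i).irr j).K = ((D i).irr j).K) ∧
      ∃ v ∈ isotypic (inputRep A i) ((D i).irr j).H ((D i).irr j).K, v ≠ 0 := by
  obtain ⟨P, hP, hrows⟩ := hA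
  obtain ⟨hne, hpar⟩ := hrows i hi
  set V := P.W i * ofDiag P.W i with hVdef
  have hVW : V * toDiag P.W i = P.W i := by
    rw [hVdef, Matrix.mul_assoc, ofDiag_mul_toDiag, Matrix.mul_one]
  have hV : ∀ g, (A.rep i).toHom g * V = V * inputRep A i g := fun g =>
    (weight_iff A P g i).mp (hP.weight i hi g)
  have hV0 : ∀ a, V a ≠ 0 := by
    intro a h
    apply hne a
    rw [← hVW]
    change V a ᵥ* _ = 0
    rw [h, zero_vecMul]
  constructor
  · refine le_antisymm (fun g hg => ?_) (le_phi D i ((D i).irr j).le ((D i).irr j).relIndex_le)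
    rw [mem_phi_iff D i ((D i).irr j).le ((D i).irr j).relIndex_le] at hg
    refine (D i).mem_of_fixes_isotypic (transpose_inputRep A i) hV (hP.bias i hi) hV0 ?_ j g hg
    rintro a a' c haa ⟨h1, h2⟩
    have h3 := smul_row_mul h1 (toDiag P.W i)
    rw [hVW] at h3
    refine hpar a a' haa ((parallel_iff fun h => hne a ?_).mpr
      ⟨c, (augmented_smul_eq_iff _ _ _ _ _).mpr ⟨h3, h2⟩⟩)
    exact funext fun k => congrFun h (Sum.inl k)
  · obtain ⟨v, hv, hrow⟩ := ((D i).intertwines_iff (transpose_inputRep A i) V).mp hV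
    refine ⟨v j, hv j, fun h => hV0 ((D i).labels ⟨j, ((1 : G) : G ⧸ ((D i).irr j).H)⟩) ?_⟩
    rw [hrow, h, mulVec_zero]

theorem Architecture.admissible_of_phi_eq (A : Architecture G L)
    (D : ∀ i, Decomposition (A.rep i))
    (hphi : ∀ i ≤ L, ∀ j : Fin (D i).r, phi D i ((D i).irr j).H ((D i).irr j).K = ((D i).irr j).K)
    (h0 : (∃ j : Fin (D 0).r, ((D 0).irr j).H = ⊤ ∧ ((D 0).irr j).K = ⊤) →
      invProj (Set.range (defRep G)) ≠ 0) : A.Admissible := by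
  -- The bound i ≤ L sits under the existential so that `choose` yields a family over all i, as
  -- `exists_weights` expects.
  have hlayer : ∀ i, ∃ V : Matrix (Fin (A.width i)) (Inputs m A.width i) ℝ, i ≤ L →
      (∀ g, (A.rep i).toHom g * V = V * inputRep A i g) ∧ (∀ a, V a ≠ 0) ∧
      ∀ a a' (c : ℝ), a ≠ a' → ¬ (c • V a = V a' ∧ c * (D i).bias a = (D i).bias a') := by
    intro i
    by_cases hi : i ≤ L
    · obtain ⟨V, hV⟩ := (D i).exists_intertwiner (transpose_inputRep A i) fun j =>
        exists_isotypic_stabilizer (inputRep A i)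
          (fun g hg => by
            rw [← hphi i hi j]
            exact (mem_phi_iff D i ((D i).irr j).le ((D i).irr j).relIndex_le g).mpr hg)
          (exists_isotypic_ne_zero A D h0 hi j (hphi i hi j))
      exact ⟨V, fun _ => hV⟩
    · exact ⟨0, fun h => absurd h hi⟩
  choose V hV using hlayer
  obtain ⟨W, hW⟩ := exists_weights V
  let P : Params m A.width := ⟨W, fun i => (D i).bias⟩
  have hweight : ∀ i ≤ L, ∀ g, (A.rep i).toHom g * P.W i = P.W i * psi A P g i := by
    intro i hi g
    rw [weight_iff]
    change (A.rep i).toHom g * (W i * ofDiag W i) = W i * ofDiag W i * _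
    rw [hW]
    exact (hV i hi).1 g
  have hbias : ∀ i ≤ L, ∀ g, (A.rep i).toHom g *ᵥ P.b i = P.b i :=
    fun i _ g => (D i).toHom_mulVec_bias g
  refine ⟨P, ⟨hweight, hbias, network_invariant A P hweight hbias
    fun i _ g => (D i).permPart_mulVec_bias g⟩, fun i hi => ?_⟩
  obtain ⟨-, hV0, hVpar⟩ := hV i hi
  have hW0 : ∀ a, P.W i a ≠ 0 := by
    intro a h
    apply hV0 a
    rw [← hW]
    change P.W i a ᵥ* _ = 0
    rw [h, zero_vecMul]
  refine ⟨hW0, fun a a' haa h => ?_⟩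
  obtain ⟨c, hc⟩ := (parallel_iff fun h => hW0 a (funext fun k => congrFun h (Sum.inl k))).mp h
  obtain ⟨h1, h2⟩ := (augmented_smul_eq_iff _ _ _ _ _).mp hc
  have h3 := smul_row_mul h1 (ofDiag W i)
  change c • (W i * ofDiag W i) a = (W i * ofDiag W i) a' at h3
  rw [hW] at h3
  exact hVpar a a' c haa ⟨h3, h2⟩

end Admissible

end GDNN

end

theorem mainTheorem1 {m : ℕ} (G : Subgroup (Matrix.orthogonalGroup (Fin m) ℝ)) [Fintype G]
    (L : ℕ) (A : GDNN.Architecture G L) (D : ∀ i, GDNN.Decomposition (A.rep i)) :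
    A.Admissible ↔
      (∀ i ≤ L, ∀ j : Fin (D i).r,
        GDNN.phi D i ((D i).irr j).H ((D i).irr j).K = ((D i).irr j).K) ∧
      ((∃ j : Fin (D 0).r, ((D 0).irr j).H = ⊤ ∧ ((D 0).irr j).K = ⊤) →
        GDNN.invProj (Set.range (GDNN.defRep G)) ≠ 0) := by
  refine ⟨fun h => ⟨fun i hi j => (h.phi_eq D hi j).1, ?_⟩,
    fun h => A.admissible_of_phi_eq D h.1 h.2⟩
  rintro ⟨j, hH, hK⟩
  obtain ⟨v, hv, hv0⟩ := (h.phi_eq D (Nat.zero_le L) j).2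
  rw [hH, hK] at hv
  exact (GDNN.invProj_range_ne_zero_iff (GDNN.defRep G)).mpr ⟨v, hv, hv0⟩
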